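/- Conventions. For partial operations, $x\simeq y$ (Kleene equality) means that both sides are undefined or both are defined and equal; $x\preceq y$ means that if $x$ is defined, then so is $y$ and they are equal; $x\!\downarrow$ means that $x$ is defined. A *partial trace* on a strict symmetric monoidal category $(\mathcal C,\otimes,I,\sigma)$ is a family of partial functions $\mathrm{Tr}^U_{A,B}:\mathcal C(A\otimes U,B\otimes U)\rightharpoonup\mathcal C(A,B)$ with: (naturality) $h\circ\mathrm{Tr}^U(f)\circ g\preceq\mathrm{Tr}^U((h\otimes 1_U)\circ f\circ(g\otimes 1_U))$; (dinaturality) $\mathrm{Tr}^U((1_B\otimes g)\circ f)\simeq\mathrm{Tr}^{U'}(f\circ(1_A\otimes g))$ for $f:A\otimes U\to B\otimes U'$, $g:U'\to U$; (strength) $g\otimes\mathrm{Tr}^U(f)\preceq\mathrm{Tr}^U(g\otimes f)$; (vanishing) $\mathrm{Tr}^I(f)\simeq f$, and if $\mathrm{Tr}^V(f)\!\downarrow$ then $\mathrm{Tr}^U(\mathrm{Tr}^V(f))\simeq\mathrm{Tr}^{U\otimes V}(f)$; (yanking) $\mathrm{Tr}^A(\sigma_{A,A})\simeq 1_A$. A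 *paracategory* is a directed graph with a partial operation $[-]$ sending paths $A\to B$ to arrows $A\to B$, such that $[\epsilon_A]\!\downarrow$ for the empty path $\epsilon_A$ (write $1_A=[\epsilon_A]$), $[f]\simeq f$ for paths of length one, and $[\vec r,[\vec f],\vec s]\simeq[\vec r,\vec f,\vec s]$ whenever $[\vec f]\!\downarrow$. A *functor* of paracategories is a graph homomorphism $F$ with $F[\vec p]\preceq[F\vec p]$ for all paths $\vec p$. A category is a paracategory with $[f_1,\dots,f_n]=f_n\circ\dots\circ f_1$. The product of paracategories has componentwise (partial) composition. A *strict symmetric monoidal paracategory* is a paracategory with a functor $\otimes$ of two variables and an object $I$, strictly associative and unital on objects and arrows, and arrows $\sigma_{A,B}:A\otimes B\to B\otimes A$ such that $[1_X\otimes\sigma_{A,B},f]\!\downarrow$ and $[g,1_X\otimes\sigma_{A,B}]\!\downarrow$ for all composable $f,g$; $[f\otimes 1_B,\sigma]=[\sigma,1_B\otimes f]$ and $[1_A\otimes g,\sigma]=[\sigma,g\otimes 1_A]$; $[\sigma_{A,B},\sigma_{B,A}]=1_{A\otimes B}$; and $\sigma_{A,B\otimes C}=[\sigma_{A,B}\otimes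 1_C,1_B\otimes\sigma_{A,C}]$. It is *compact closed* if every object $A$ is given an object $A^*$ and arrows $\eta_A:I\to A^*\otimes A$, $\varepsilon_A:A\otimes A^*\to I$ such that $[1_A\otimes\eta_C,f\otimes 1_C]$, $[g\otimes 1_{C^*},1_B\otimes\varepsilon_C]$, $[\eta_A\otimes 1_B,1_{A^*}\otimes h]$, $[1_A\otimes k,\varepsilon_A\otimes 1_C]$ are defined for all $f:A\otimes C^*\to B$, $g:A\to B\otimes C$, $h:A\otimes B\to C$, $k:B\to A^*\otimes C$, and $[1_A\otimes\eta_A,\varepsilon_A\otimes 1_A]=1_A$, $[\eta_A\otimes 1_{A^*},1_{A^*}\otimes\varepsilon_A]=1_{A^*}$. A functor $F$ between strict symmetric monoidal paracategories is *strict symmetric monoidal* if it preserves $\otimes$ (on objects and arrows), $I$ and $\sigma$ on the nose. Let $(\mathcal C,\mathrm{Tr})$ be a strict symmetric monoidal category with a partial trace. Define $\mathrm{Int}^p(\mathcal C)$ as follows. Objects are pairs $(A^+,A^-)$ of objects of $\mathcal C$; an arrow $(A^+,A^-)\to(B^+,B^-)$ is a morphism $A^+\otimes B^-\to B^+\otimes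 A^-$ of $\mathcal C$. For a path $\vec p=p_1,\dots,p_n$ with $p_i:(A_{i-1}^+,A_{i-1}^-)\to(A_i^+,A_i^-)$ put $\vec A^-=A_0^-\otimes\dots\otimes A_{n-1}^-$ and define $\langle\vec p\rangle:A_0^+\otimes\vec A^-\otimes A_n^-\to A_n^+\otimes A_0^-\otimes\vec A^-$ recursively by $\langle\epsilon\rangle=1$ and $$\langle\vec p,p_{n+1}\rangle=(1\otimes\sigma_{A_n^-,A_0^-\otimes\vec A^-})\circ(p_{n+1}\otimes 1)\circ(1\otimes\sigma_{A_0^-\otimes\vec A^-,A_{n+1}^-})\circ(\langle\vec p\rangle\otimes 1);$$ the composition is $[\vec p]\simeq\mathrm{Tr}^{\vec A^-}(\langle\vec p\rangle\circ(1_{A_0^+}\otimes\sigma_{A_n^-,\vec A^-}))$. The tensor is $(A^+,A^-)\otimes(B^+,B^-)=(A^+\otimes B^+,B^-\otimes A^-)$ with unit $(I,I)$, and for $f:(A^+,A^-)\to(C^+,C^-)$, $g:(B^+,B^-)\to(D^+,D^-)$ the arrow $f\otimes g$ is $(1\otimes\sigma_{A^-,D^+\otimes B^-})\circ(f\otimes_{\mathcal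 C}g)\circ(1\otimes\sigma_{B^+\otimes D^-,C^-})$. The symmetry is $\sigma_{A^+,B^+}\otimes\sigma_{A^-,B^-}$; the dual is $(A,B)^*=(B,A)$, with $\eta_{(A,B)}=1_{B\otimes A}$ and $\varepsilon_{(A,B)}=1_{A\otimes B}$. **Theorem.** For every strict symmetric monoidal category $\mathcal C$ with a partial trace, $\mathrm{Int}^p(\mathcal C)$ is a strict symmetric compact closed paracategory. The category $\mathcal C$, with its total composition, is a strict symmetric monoidal paracategory, and $N(A)=(A,I)$, $N(f)=f$ defines a full and faithful (bijective on each hom-set) strict symmetric monoidal functor of paracategories $N:\mathcal C\to\mathrm{Int}^p(\mathcal C)$. In particular, every partially traced strict symmetric monoidal category has a full and faithful strict symmetric monoidal functor into a compact closed paracategory. -/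

import Mathlib

open CategoryTheory MonoidalCategory

universe v u v' u'

/-! ### Partially traced categories

Partial operations take values in `Part`: equality in `Part` is Kleene equality (both sides
undefined, or both defined and equal) and `≤` in `Part` is directed Kleene equality (if the left
side is defined, then so is the right side, and they are equal). -/

/-- A monoidal category is strict if its associator and unitors are identities. -/
class IsStrictMonoidal (C : Type u) [Category.{v} C] [MonoidalCategory C] : Prop where
  tensor_assoc : ∀ X Y Z : C, (X ⊗ Y) ⊗ Z = X ⊗ (Y ⊗ Z)
  unit_tensor : ∀ X : C, 𝟙_ C ⊗ X = X
  tensor_unit : ∀ X : C, X ⊗ 𝟙_ C = X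
  associator_eq : ∀ X Y Z : C, α_ X Y Z = eqToIso (tensor_assoc X Y Z)
  leftUnitor_eq : ∀ X : C, λ_ X = eqToIso (unit_tensor X)
  rightUnitor_eq : ∀ X : C, ρ_ X = eqToIso (tensor_unit X)

/-- A partial trace on a symmetric monoidal category (the structural isomorphisms, which are
identities in the strict case, are written out). -/
structure PartialTrace (C : Type u) [Category.{v} C] [MonoidalCategory C]
    [SymmetricCategory C] where
  tr : ∀ {A B : C} (U : C), (A ⊗ U ⟶ B ⊗ U) → Part (A ⟶ B)
  naturality : ∀ {A B A' B' U : C} (f : A ⊗ U ⟶ B ⊗ U) (g : A' ⟶ A) (h : B ⟶ B'),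
    (tr U f).map (fun t => g ≫ t ≫ h) ≤ tr U ((g ▷ U) ≫ f ≫ (h ▷ U))
  dinaturality : ∀ {A B U U' : C} (f : A ⊗ U ⟶ B ⊗ U') (g : U' ⟶ U),
    tr U (f ≫ (B ◁ g)) = tr U' ((A ◁ g) ≫ f)
  strength : ∀ {A B U X Y : C} (f : A ⊗ U ⟶ B ⊗ U) (g : X ⟶ Y),
    (tr U f).map (fun t => g ⊗ₘ t) ≤ tr U ((α_ X A U).hom ≫ (g ⊗ₘ f) ≫ (α_ Y B U).inv)
  vanishing_one : ∀ {A B : C} (f : A ⊗ 𝟙_ C ⟶ B ⊗ 𝟙_ C),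
    tr (𝟙_ C) f = Part.some ((ρ_ A).inv ≫ f ≫ (ρ_ B).hom)
  vanishing_two : ∀ {A B U V : C} (f : (A ⊗ U) ⊗ V ⟶ (B ⊗ U) ⊗ V) (h : (tr V f).Dom),
    tr U ((tr V f).get h) = tr (U ⊗ V) ((α_ A U V).inv ≫ f ≫ (α_ B U V).hom)
  yanking : ∀ A : C, tr A (β_ A A).hom = Part.some (𝟙 A)

/-! ### Paracategories -/

/-- A directed graph with a partial operation from paths to arrows: the data of a
paracategory. -/
structure ParaData where
  Obj : Type u
  [quiver : Quiver.{v} Obj]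
  comp : ∀ {A B : Obj}, Quiver.Path A B → Part (A ⟶ B)

attribute [instance] ParaData.quiver

namespace ParaData

/-- The axioms of a paracategory. -/
structure IsParacategory (P : ParaData.{v, u}) : Prop where
  comp_nil_dom : ∀ A : P.Obj, (P.comp (Quiver.Path.nil : Quiver.Path A A)).Dom
  comp_toPath : ∀ {A B : P.Obj} (f : A ⟶ B), P.comp f.toPath = Part.some f
  comp_comp : ∀ {A B C D : P.Obj} (r : Quiver.Path A B) (f : Quiver.Path B C)
    (s : Quiver.Path C D) (h : (P.comp f).Dom),
    P.comp ((r.comp ((P.comp f).get h).toPath).comp s) = P.comp ((r.comp f).comp s)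

/-- The identity arrow `1_A = [ε_A]`. -/
def IsParacategory.one {P : ParaData.{v, u}} (h : P.IsParacategory) (A : P.Obj) : A ⟶ A :=
  (P.comp Quiver.Path.nil).get (h.comp_nil_dom A)

/-- The partial composition `[f, g]` of a path of length two. -/
def comp₂ (P : ParaData.{v, u}) {A B C : P.Obj} (f : A ⟶ B) (g : B ⟶ C) : Part (A ⟶ C) :=
  P.comp (f.toPath.cons g)

/-- A graph homomorphism `F` is a functor of paracategories if `F[p]` is directed Kleene equal to
`[F p]` for every path `p`. -/
def IsFunctor {P : ParaData.{v, u}} {Q : ParaData.{v', u'}} (F : P.Obj ⥤q Q.Obj) : Prop :=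
  ∀ (A B : P.Obj) (p : Quiver.Path A B), (P.comp p).map F.map ≤ Q.comp (F.mapPath p)

/-- The product graph. -/
abbrev prodQuiver (P : ParaData.{v, u}) (Q : ParaData.{v', u'}) :
    Quiver.{max v v'} (P.Obj × Q.Obj) where
  Hom X Y := (X.1 ⟶ Y.1) × (X.2 ⟶ Y.2)

/-- First projection of the product graph. -/
def fst (P : ParaData.{v, u}) (Q : ParaData.{v', u'}) :
    @Prefunctor (P.Obj × Q.Obj) (prodQuiver P Q) P.Obj _ :=
  letI := prodQuiver P Q
  { obj := fun X => X.1, map := fun f => f.1 }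

/-- Second projection of the product graph. -/
def snd (P : ParaData.{v, u}) (Q : ParaData.{v', u'}) :
    @Prefunctor (P.Obj × Q.Obj) (prodQuiver P Q) Q.Obj _ :=
  letI := prodQuiver P Q
  { obj := fun X => X.2, map := fun f => f.2 }

/-- The product: `[(f₁,g₁),…,(fₙ,gₙ)]` is `([f₁,…,fₙ], [g₁,…,gₙ])`, defined when both components
are. -/
def prod (P : ParaData.{v, u}) (Q : ParaData.{v', u'}) : ParaData.{max v v', max u u'} :=
  letI := prodQuiver P Q
  { Obj := P.Obj × Q.Obj
    comp := fun p =>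
      (P.comp ((fst P Q).mapPath p)).bind fun f =>
        (Q.comp ((snd P Q).mapPath p)).map fun g => (f, g) }

end ParaData

/-! ### Symmetric monoidal paracategories -/

/-- The data of a strict symmetric monoidal paracategory. -/
structure SymMonParaData extends ParaData.{v, u} where
  tensor : (ParaData.prod toParaData toParaData).Obj ⥤q Obj
  unit : Obj
  sym : ∀ A B : Obj, tensor.obj (A, B) ⟶ tensor.obj (B, A)

namespace SymMonParaData

/-- The tensor product of objects. -/
abbrev tObj (P : SymMonParaData.{v, u}) (A B : P.Obj) : P.Obj := P.tensor.obj (A, B)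

/-- The tensor product of arrows. -/
abbrev tHom (P : SymMonParaData.{v, u}) {A B A' B' : P.Obj} (f : A ⟶ B) (g : A' ⟶ B') :
    P.tObj A A' ⟶ P.tObj B B' :=
  P.tensor.map (X := (A, A')) (Y := (B, B')) (f, g)

/-- The symmetry. -/
abbrev σ (P : SymMonParaData.{v, u}) (A B : P.Obj) : P.tObj A B ⟶ P.tObj B A := P.sym A B

/-- The axioms of a strict symmetric monoidal paracategory. `Quiver.Hom.cast` transports an
arrow along equalities of its source and target. -/
structure IsStrictSymmetricMonoidal (P : SymMonParaData.{v, u}) : Prop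
    extends P.toParaData.IsParacategory where
  tensor_isFunctor : ParaData.IsFunctor P.tensor
  assoc_obj : ∀ A B C : P.Obj, P.tObj (P.tObj A B) C = P.tObj A (P.tObj B C)
  assoc_hom : ∀ {A B C A' B' C' : P.Obj} (f : A ⟶ A') (g : B ⟶ B') (h : C ⟶ C'),
    (P.tHom (P.tHom f g) h).cast (assoc_obj A B C) (assoc_obj A' B' C') = P.tHom f (P.tHom g h)
  tensor_unit_obj : ∀ A : P.Obj, P.tObj A P.unit = A
  unit_tensor_obj : ∀ A : P.Obj, P.tObj P.unit A = A
  tensor_unit_hom : ∀ {A B : P.Obj} (f : A ⟶ B),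
    (P.tHom f (toIsParacategory.one P.unit)).cast (tensor_unit_obj A) (tensor_unit_obj B) = f
  unit_tensor_hom : ∀ {A B : P.Obj} (f : A ⟶ B),
    (P.tHom (toIsParacategory.one P.unit) f).cast (unit_tensor_obj A) (unit_tensor_obj B) = f
  sym_total_left : ∀ {X A B Y : P.Obj} (f : P.tObj X (P.tObj B A) ⟶ Y),
    (P.comp₂ (P.tHom (toIsParacategory.one X) (P.σ A B)) f).Dom
  sym_total_right : ∀ {X A B Y : P.Obj} (g : Y ⟶ P.tObj X (P.tObj A B)),
    (P.comp₂ g (P.tHom (toIsParacategory.one X) (P.σ A B))).Dom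
  sym_natural_left : ∀ {A A' : P.Obj} (B : P.Obj) (f : A ⟶ A'),
    P.comp₂ (P.tHom f (toIsParacategory.one B)) (P.σ A' B) =
      P.comp₂ (P.σ A B) (P.tHom (toIsParacategory.one B) f)
  sym_natural_right : ∀ (A : P.Obj) {B B' : P.Obj} (g : B ⟶ B'),
    P.comp₂ (P.tHom (toIsParacategory.one A) g) (P.σ A B') =
      P.comp₂ (P.σ A B) (P.tHom g (toIsParacategory.one A))
  sym_sym : ∀ A B : P.Obj,
    P.comp₂ (P.σ A B) (P.σ B A) = Part.some (toIsParacategory.one (P.tObj A B))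
  hexagon : ∀ A B C : P.Obj,
    P.comp₂
      ((P.tHom (P.σ A B) (toIsParacategory.one C)).cast (assoc_obj A B C) (assoc_obj B A C))
      ((P.tHom (toIsParacategory.one B) (P.σ A C)).cast rfl (assoc_obj B C A).symm) =
    Part.some (P.σ A (P.tObj B C))

/-- A strict symmetric monoidal functor. -/
structure IsStrictSymmetricMonoidalFunctor {P : SymMonParaData.{v, u}}
    {Q : SymMonParaData.{v', u'}} (F : P.Obj ⥤q Q.Obj) : Prop where
  isFunctor : ParaData.IsFunctor F
  tensor_obj : ∀ A B : P.Obj, Q.tObj (F.obj A) (F.obj B) = F.obj (P.tObj A B)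
  unit_obj : F.obj P.unit = Q.unit
  tensor_hom : ∀ {A B A' B' : P.Obj} (f : A ⟶ B) (g : A' ⟶ B'),
    (Q.tHom (F.map f) (F.map g)).cast (tensor_obj A A') (tensor_obj B B') = F.map (P.tHom f g)
  sym_hom : ∀ A B : P.Obj,
    (Q.σ (F.obj A) (F.obj B)).cast (tensor_obj A B) (tensor_obj B A) = F.map (P.σ A B)

end SymMonParaData

/-! ### Compact closed paracategories -/

/-- The data of a strict symmetric compact closed paracategory. -/
structure CompactClosedParaData extends SymMonParaData.{v, u} where
  dual : Obj → Obj
  η : ∀ A : Obj, unit ⟶ toSymMonParaData.tObj (dual A) A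
  ε : ∀ A : Obj, toSymMonParaData.tObj A (dual A) ⟶ unit

/-- The axioms of a strict symmetric compact closed paracategory. -/
structure CompactClosedParaData.IsCompactClosed (P : CompactClosedParaData.{v, u}) : Prop
    extends P.toSymMonParaData.IsStrictSymmetricMonoidal where
  total_unit_right : ∀ {A B C : P.Obj} (f : P.tObj A (P.dual C) ⟶ B),
    (P.comp₂ (P.tHom (toIsParacategory.one A) (P.η C))
      ((P.tHom f (toIsParacategory.one C)).cast (assoc_obj A (P.dual C) C) rfl)).Dom
  total_counit_right : ∀ {A B C : P.Obj} (g : A ⟶ P.tObj B C),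
    (P.comp₂
      ((P.tHom g (toIsParacategory.one (P.dual C))).cast rfl (assoc_obj B C (P.dual C)))
      (P.tHom (toIsParacategory.one B) (P.ε C))).Dom
  total_unit_left : ∀ {A B C : P.Obj} (h : P.tObj A B ⟶ C),
    (P.comp₂ ((P.tHom (P.η A) (toIsParacategory.one B)).cast rfl (assoc_obj (P.dual A) A B))
      (P.tHom (toIsParacategory.one (P.dual A)) h)).Dom
  total_counit_left : ∀ {A B C : P.Obj} (k : B ⟶ P.tObj (P.dual A) C),
    (P.comp₂ (P.tHom (toIsParacategory.one A) k)
      ((P.tHom (P.ε A) (toIsParacategory.one C)).cast (assoc_obj A (P.dual A) C) rfl)).Dom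
  snake : ∀ A : P.Obj,
    P.comp₂ ((P.tHom (toIsParacategory.one A) (P.η A)).cast (tensor_unit_obj A) rfl)
      ((P.tHom (P.ε A) (toIsParacategory.one A)).cast (assoc_obj A (P.dual A) A)
        (unit_tensor_obj A)) =
    Part.some (toIsParacategory.one A)
  snake_dual : ∀ A : P.Obj,
    P.comp₂
      ((P.tHom (P.η A) (toIsParacategory.one (P.dual A))).cast (unit_tensor_obj (P.dual A))
        (assoc_obj (P.dual A) A (P.dual A)))
      ((P.tHom (toIsParacategory.one (P.dual A)) (P.ε A)).cast rfl
        (tensor_unit_obj (P.dual A))) =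
    Part.some (toIsParacategory.one (P.dual A))

/-! ### Categories as paracategories -/

/-- A category, with the total composition of paths. -/
abbrev paraOfCategory (C : Type u) [Category.{v} C] : ParaData.{v, u} where
  Obj := C
  comp p := Part.some (composePath p)

/-- A symmetric monoidal category, with the total composition of paths. -/
abbrev symMonParaOfCategory (C : Type u) [Category.{v} C] [MonoidalCategory C]
    [SymmetricCategory C] : SymMonParaData.{v, u} where
  toParaData := paraOfCategory C
  tensor :=
    { obj := fun X => tensorObj (C := C) X.1 X.2
      map := fun f => tensorHom (C := C) f.1 f.2 }
  unit := 𝟙_ C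
  sym := fun A B : C => (β_ A B).hom

/-! ### The partial Int-construction -/

/-- Objects of the partial Int-construction: pairs `(A⁺, A⁻)`. -/
@[ext]
structure IntObj (C : Type u) where
  pos : C
  neg : C

namespace IntObj

variable {C : Type u} [Category.{v} C] [MonoidalCategory C]

/-- An arrow `A ⟶ B` is a morphism `A⁺ ⊗ B⁻ ⟶ B⁺ ⊗ A⁻`. -/
instance : Quiver.{v} (IntObj C) where
  Hom A B := A.pos ⊗ B.neg ⟶ B.pos ⊗ A.neg

/-- The morphism of `C` underlying an arrow. -/
abbrev mor {A B : IntObj C} (f : A ⟶ B) : A.pos ⊗ B.neg ⟶ B.pos ⊗ A.neg := f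

/-- The arrow given by a morphism of `C`. -/
abbrev ofMor {A B : IntObj C} (f : A.pos ⊗ B.neg ⟶ B.pos ⊗ A.neg) : A ⟶ B := f

/-- For a path `A₀, …, Aₙ`, the object `A₀⁻ ⊗ … ⊗ Aₙ₋₁⁻`. -/
def vec {A : IntObj C} : ∀ {B : IntObj C}, Quiver.Path A B → C
  | _, .nil => 𝟙_ C
  | _, .cons (b := B) p _ => vec p ⊗ B.neg

variable [SymmetricCategory C]

/-- Precomposition: `A₀⁺ ⊗ (A₀⁻ ⊗ … ⊗ Aₙ₋₁⁻) ⊗ Aₙ⁻ ⟶ Aₙ⁺ ⊗ A₀⁻ ⊗ (A₀⁻ ⊗ … ⊗ Aₙ₋₁⁻)`, by recursion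
on the path. -/
def precomp {A : IntObj C} : ∀ {B : IntObj C} (p : Quiver.Path A B),
    (A.pos ⊗ (vec p ⊗ B.neg) ⟶ B.pos ⊗ (A.neg ⊗ vec p))
  | _, .nil => A.pos ◁ ((λ_ A.neg).hom ≫ (ρ_ A.neg).inv)
  | D, .cons (b := B) p e =>
    (α_ A.pos (vec p ⊗ B.neg) D.neg).inv ≫
      (precomp p ▷ D.neg) ≫
      (α_ B.pos (A.neg ⊗ vec p) D.neg).hom ≫
      (B.pos ◁ (β_ (A.neg ⊗ vec p) D.neg).hom) ≫
      (α_ B.pos D.neg (A.neg ⊗ vec p)).inv ≫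
      (mor e ▷ (A.neg ⊗ vec p)) ≫
      (α_ D.pos B.neg (A.neg ⊗ vec p)).hom ≫
      (D.pos ◁ (β_ B.neg (A.neg ⊗ vec p)).hom) ≫
      (D.pos ◁ (α_ A.neg (vec p) B.neg).hom)

/-- Partial composition of a path: a single partial trace over `A₀⁻ ⊗ … ⊗ Aₙ₋₁⁻`. -/
def pathComp (T : PartialTrace C) {A B : IntObj C} (p : Quiver.Path A B) : Part (A ⟶ B) :=
  T.tr (vec p)
    ((α_ A.pos B.neg (vec p)).hom ≫ (A.pos ◁ (β_ B.neg (vec p)).hom) ≫ precomp p ≫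
      (α_ B.pos A.neg (vec p)).inv)

/-- `(A⁺, A⁻) ⊗ (B⁺, B⁻) = (A⁺ ⊗ B⁺, B⁻ ⊗ A⁻)`. -/
def tens (A B : IntObj C) : IntObj C := ⟨A.pos ⊗ B.pos, B.neg ⊗ A.neg⟩

/-- The tensor of `f : A ⟶ D` and `g : B ⟶ E`: the symmetry gathers the inputs of `f` and of `g`,
then `f ⊗ g` is applied, and the symmetry rearranges the outputs. -/
def tensHom {A B D E : IntObj C} (f : A ⟶ D) (g : B ⟶ E) : tens A B ⟶ tens D E :=
  ofMor (A := tens A B) (B := tens D E)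
    ((α_ A.pos B.pos (E.neg ⊗ D.neg)).hom ≫
      (A.pos ◁ (α_ B.pos E.neg D.neg).inv) ≫
      (A.pos ◁ (β_ (B.pos ⊗ E.neg) D.neg).hom) ≫
      (α_ A.pos D.neg (B.pos ⊗ E.neg)).inv ≫
      (mor f ⊗ₘ mor g) ≫
      (α_ D.pos A.neg (E.pos ⊗ B.neg)).hom ≫
      (D.pos ◁ (β_ A.neg (E.pos ⊗ B.neg)).hom) ≫
      (D.pos ◁ (α_ E.pos B.neg A.neg).hom) ≫
      (α_ D.pos E.pos (B.neg ⊗ A.neg)).inv)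

/-- The symmetry, the morphism `σ_{A⁺,B⁺} ⊗ σ_{A⁻,B⁻}` from `(A⁺ ⊗ B⁺) ⊗ (A⁻ ⊗ B⁻)` to
`(B⁺ ⊗ A⁺) ⊗ (B⁻ ⊗ A⁻)`. -/
def symm (A B : IntObj C) : tens A B ⟶ tens B A :=
  ofMor (A := tens A B) (B := tens B A) ((β_ A.pos B.pos).hom ⊗ₘ (β_ A.neg B.neg).hom)

/-- The tensor unit `(I, I)`. -/
def one : IntObj C := ⟨𝟙_ C, 𝟙_ C⟩

/-- The dual `(A, B)* = (B, A)`. -/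
def dual (A : IntObj C) : IntObj C := ⟨A.neg, A.pos⟩

/-- The unit of `(A, B)`: up to the unitors, the identity of `B ⊗ A`. -/
def unitHom (A : IntObj C) : one ⟶ tens (dual A) A :=
  ofMor (A := one) (B := tens (dual A) A)
    ((λ_ (A.neg ⊗ A.pos)).hom ≫ (ρ_ (A.neg ⊗ A.pos)).inv)

/-- The counit of `(A, B)`: up to the unitors, the identity of `A ⊗ B`. -/
def counitHom (A : IntObj C) : tens A (dual A) ⟶ one :=
  ofMor (A := tens A (dual A)) (B := one)
    ((ρ_ (A.pos ⊗ A.neg)).hom ≫ (λ_ (A.pos ⊗ A.neg)).inv)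

/-- `N(A) = (A, I)`. -/
def nObj (A : C) : IntObj C := ⟨A, 𝟙_ C⟩

/-- `N(f) = f`, up to the unitors. -/
def nHom {A B : C} (f : A ⟶ B) : nObj A ⟶ nObj B :=
  ofMor (A := nObj A) (B := nObj B) ((ρ_ A).hom ≫ f ≫ (ρ_ B).inv)

end IntObj

section

variable {C : Type u} [Category.{v} C] [MonoidalCategory C] [SymmetricCategory C]

/-- The graph of the partial Int-construction with its partial composition. -/
abbrev intPara (T : PartialTrace C) : ParaData.{v, u} where
  Obj := IntObj C
  comp p := IntObj.pathComp T p

/-- The symmetric monoidal data of the partial Int-construction. -/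
abbrev intSymMon (T : PartialTrace C) : SymMonParaData.{v, u} where
  toParaData := intPara T
  tensor :=
    { obj := fun X => IntObj.tens X.1 X.2
      map := fun f => IntObj.tensHom f.1 f.2 }
  unit := IntObj.one
  sym A B := IntObj.symm A B

/-- The partial Int-construction. -/
abbrev intP (T : PartialTrace C) : CompactClosedParaData.{v, u} where
  toSymMonParaData := intSymMon T
  dual := fun A : IntObj C => IntObj.dual A
  η := fun A : IntObj C => IntObj.unitHom A
  ε := fun A : IntObj C => IntObj.counitHom A

/-- The graph homomorphism `N` from `C` to the partial Int-construction. -/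
def intN (T : PartialTrace C) : (symMonParaOfCategory C).Obj ⥤q (intP T).Obj where
  obj := fun A : C => IntObj.nObj A
  map := fun {A B : C} (f : A ⟶ B) => IntObj.nHom f

end

/-! The composition of a path is the trace of a single morphism `loop p`, which applies the arrows
in succession and keeps the intermediate negative wires as feedback. Associativity should follow by
replacing an inner trace by its value inside a larger diagram. Kleene equality of traces is too weak
for this: naturality and strength are only directed, so the axioms let an undefined trace become
defined inside a context. The proof uses instead `LoopEq`, the equivalence relation generated by
sliding a morphism around the loop and by evaluating a trace that is defined. It implies Kleene
equality of traces (`LoopEq.tr_eq`, from dinaturality and vanishing), and it is a congruence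
(`LoopEq.ctx`), because naturality and strength do apply to a defined trace.

The paracategory law then reduces to `loopEq_star_loop`: feeding one loop into another is the loop
of the concatenated path. Functoriality of the tensor reduces to `loopEq_loop_tensorPath`: the loop
of a path of tensors is the tensor of the two loops, seen as a context of either factor. Here only
one direction of definedness is obtained, and only one is needed.

The required total compositions are those in which the feedback wires close no cycle. By yanking,
such a trace exists and unfolds to an ordinary composite (`tr_yank`, `tr_yankTwo`). The snake
equations are instances of the resulting formulas, and on the image of `intN` the feedback objects
are units.

What remains are equations between composites of boxes and structural isomorphisms. They are settled
by `diagram_eq`: if all wires carry distinct labels, the boxes and the boundary determine the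
morphism. This rests on coherence for symmetric monoidal categories (`SHom.eval_eq`) and on moving
an available box to the front (`IsSeq.exists_front`). -/

/-! ### Coherence for wiring diagrams in symmetric monoidal categories -/

namespace Wiring

/-- Bracketed words of labelled wires. -/
inductive Word : Type
  | unit : Word
  | leaf : ℕ → Word
  | node : Word → Word → Word

namespace Word

/-- The wires of a word, in order. -/
def toList : Word → List ℕ
  | unit => []
  | leaf n => [n]
  | node X Y => X.toList ++ Y.toList

/-- The multiset of wires of a word. -/
def labels : Word → Multiset ℕ
  | unit => 0
  | leaf n => {n}
  | node X Y => X.labels + Y.labels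

theorem coe_toList : ∀ X : Word, (X.toList : Multiset ℕ) = X.labels
  | unit => rfl
  | leaf _ => rfl
  | node X Y => by simp [toList, labels, ← coe_toList X, ← coe_toList Y]

/-- The right-bracketed word on a list of wires. -/
def ofList : List ℕ → Word
  | [] => unit
  | n :: l => node (leaf n) (ofList l)

theorem labels_ofList : ∀ l : List ℕ, (ofList l).labels = l
  | [] => rfl
  | n :: l => by simp [ofList, labels, labels_ofList l, Multiset.singleton_add]

end Word

open Wiring.Word

/-- Formal composites of structural isomorphisms. -/
inductive SHom : Word → Word → Type
  | id (X) : SHom X X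
  | comp {X Y Z} : SHom X Y → SHom Y Z → SHom X Z
  | tensor {X Y X' Y'} : SHom X Y → SHom X' Y' → SHom (node X X') (node Y Y')
  | assoc (X Y Z) : SHom (node (node X Y) Z) (node X (node Y Z))
  | assocInv (X Y Z) : SHom (node X (node Y Z)) (node (node X Y) Z)
  | lu (X) : SHom (node unit X) X
  | luInv (X) : SHom X (node unit X)
  | ru (X) : SHom (node X unit) X
  | ruInv (X) : SHom X (node X unit)
  | braid (X Y) : SHom (node X Y) (node Y X)

theorem SHom.labels_eq {X Y : Word} (f : SHom X Y) : X.labels = Y.labels := by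
  induction f <;> simp_all [labels, add_assoc, add_comm]

/-- Every word can be rebracketed to the right, and back. -/
theorem nonempty_ofList_append : ∀ (l : List ℕ) (Y : Word) (m : List ℕ),
    SHom Y (ofList m) → SHom (ofList m) Y →
    Nonempty (SHom (node (ofList l) Y) (ofList (l ++ m))) ∧
      Nonempty (SHom (ofList (l ++ m)) (node (ofList l) Y))
  | [], Y, m, f, g => ⟨⟨(SHom.lu Y).comp f⟩, ⟨g.comp (SHom.luInv Y)⟩⟩
  | n :: l, Y, m, f, g => by
    obtain ⟨⟨h⟩, ⟨k⟩⟩ := nonempty_ofList_append l Y m f g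
    exact ⟨⟨(SHom.assoc _ _ _).comp ((SHom.id _).tensor h)⟩,
      ⟨((SHom.id _).tensor k).comp (SHom.assocInv _ _ _)⟩⟩

theorem nonempty_toList : ∀ X : Word,
    Nonempty (SHom X (ofList X.toList)) ∧ Nonempty (SHom (ofList X.toList) X)
  | unit => ⟨⟨SHom.id _⟩, ⟨SHom.id _⟩⟩
  | leaf _ => ⟨⟨SHom.ruInv _⟩, ⟨SHom.ru _⟩⟩
  | node X Y => by
    obtain ⟨⟨f⟩, ⟨g⟩⟩ := nonempty_toList X
    obtain ⟨⟨h⟩, ⟨k⟩⟩ := nonempty_toList Y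
    obtain ⟨⟨a⟩, ⟨b⟩⟩ := nonempty_ofList_append X.toList Y Y.toList h k
    exact ⟨⟨(f.tensor (SHom.id _)).comp a⟩, ⟨b.comp (g.tensor (SHom.id _))⟩⟩

theorem nonempty_of_perm {l m : List ℕ} (h : l.Perm m) :
    Nonempty (SHom (ofList l) (ofList m)) := by
  induction h with
  | nil => exact ⟨SHom.id _⟩
  | cons n _ ih => exact ih.map fun f => (SHom.id _).tensor f
  | swap a b l =>
    exact ⟨(SHom.assocInv _ _ _).comp (((SHom.braid _ _).tensor (SHom.id _)).comp
      (SHom.assoc _ _ _))⟩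
  | trans _ _ ih ih' => exact ih.elim fun f => ih'.map fun g => f.comp g

/-- Both words are rebracketed to the right; equal multisets of labels then differ by a permutation,
which is built from adjacent braidings. -/
theorem nonempty_of_labels_eq {X Y : Word} (h : X.labels = Y.labels) : Nonempty (SHom X Y) := by
  obtain ⟨f⟩ := (nonempty_toList X).1
  obtain ⟨g⟩ := (nonempty_toList Y).2
  rw [← coe_toList, ← coe_toList, Multiset.coe_eq_coe] at h
  obtain ⟨k⟩ := nonempty_of_perm h
  exact ⟨f.comp (k.comp g)⟩

/-! ### Evaluation of words and symmetric coherence -/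

section Eval

variable {C : Type u} [Category.{v} C] [MonoidalCategory C]

/-- The object denoted by a word under a valuation of the wires. -/
def ev (w : ℕ → C) : Word → C
  | unit => 𝟙_ C
  | leaf n => w n
  | node X Y => ev w X ⊗ ev w Y

/-- A family of morphisms between valuations extends to all words. -/
def evMap {w w' : ℕ → C} (φ : ∀ n, w n ⟶ w' n) : ∀ X, ev w X ⟶ ev w' X
  | unit => 𝟙 _
  | leaf n => φ n
  | node X Y => evMap φ X ⊗ₘ evMap φ Y

instance {w w' : ℕ → C} (φ : ∀ n, w n ⟶ w' n) [∀ n, IsIso (φ n)] : ∀ X, IsIso (evMap φ X)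
  | unit => inferInstanceAs (IsIso (𝟙 _))
  | leaf n => inferInstanceAs (IsIso (φ n))
  | node X Y => by
    have := instIsIsoEvMap φ X
    have := instIsIsoEvMap φ Y
    exact inferInstanceAs (IsIso (evMap φ X ⊗ₘ evMap φ Y))

theorem comp_inv_tensorHom_inv {A B A₁ A₂ B₁ B₂ : C} {e : A ≅ B} {e₁ : A₁ ≅ B₁} {e₂ : A₂ ≅ B₂}
    {a : A ⟶ A₁ ⊗ A₂} {b : B ⟶ B₁ ⊗ B₂} (h : e.hom ≫ b = a ≫ (e₁.hom ⊗ₘ e₂.hom)) :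
    e.inv ≫ a = b ≫ (e₁.inv ⊗ₘ e₂.inv) := by
  rw [Iso.inv_comp_eq, reassoc_of% h]
  simp

/-! Words with a single wire not labelled by the unit. -/

/-- The number of occurrences of a wire. -/
def cnt (i : ℕ) : Word → ℕ
  | unit => 0
  | leaf n => if n = i then 1 else 0
  | node X Y => cnt i X + cnt i Y

theorem cnt_eq_count (i : ℕ) : ∀ X : Word, cnt i X = X.labels.count i
  | unit => rfl
  | leaf n => by simp [cnt, labels, Multiset.count_singleton, eq_comm]
  | node X Y => by simp [cnt, labels, cnt_eq_count i X, cnt_eq_count i Y]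

/-- The object `A` for one occurrence, the unit for none. -/
def power (A : C) : ℕ → C
  | 1 => A
  | _ => 𝟙_ C

/-- Multiplication of occurrences. -/
def powerMul (A : C) : ∀ a b : ℕ, a + b ≤ 1 → (power A a ⊗ power A b ≅ power A (a + b))
  | 0, 0, _ => λ_ (𝟙_ C)
  | 0, 1, _ => λ_ A
  | 1, 0, _ => ρ_ A
  | 1, 1, h => absurd h (by omega)
  | 0, _ + 2, h => absurd h (by omega)
  | 1, _ + 2, h => absurd h (by omega)
  | _ + 2, _, h => absurd h (by omega)

/-- The valuation with one non-unit wire. -/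
def single (i : ℕ) (A : C) (n : ℕ) : C := power A (cnt i (leaf n))

/-- Removing the unit wires. -/
def collapse (i : ℕ) (A : C) : ∀ X, cnt i X ≤ 1 → (ev (single i A) X ≅ power A (cnt i X))
  | unit, _ => Iso.refl _
  | leaf _, _ => Iso.refl _
  | node X Y, h =>
    (collapse i A X ((Nat.le_add_right _ _).trans h) ⊗ᵢ
      collapse i A Y ((Nat.le_add_left _ _).trans h)) ≪≫ powerMul A _ _ h

theorem powerMul_assoc (A : C) (a b c : ℕ) (h : a + b + c ≤ 1) :
    (α_ _ _ _).hom ≫ (_ ◁ (powerMul A b c (by omega)).hom) ≫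
      (powerMul A a (b + c) (by omega)).hom =
    ((powerMul A a b (by omega)).hom ▷ _) ≫ (powerMul A (a + b) c h).hom ≫
      eqToHom (by rw [Nat.add_assoc]) := by
  obtain ⟨rfl, rfl, rfl⟩ | ⟨rfl, rfl, rfl⟩ | ⟨rfl, rfl, rfl⟩ | ⟨rfl, rfl, rfl⟩ :
    (a = 0 ∧ b = 0 ∧ c = 0) ∨ (a = 1 ∧ b = 0 ∧ c = 0) ∨ (a = 0 ∧ b = 1 ∧ c = 0) ∨
      (a = 0 ∧ b = 0 ∧ c = 1) := by omega
  all_goals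
    change _ ≫ _ ≫ _ = _ ≫ _ ≫ 𝟙 _
    dsimp only [powerMul, power]
    monoidal

theorem collapse_assoc {A B D A' B' D' AB BD L R : C} (a : A ⟶ A') (b : B ⟶ B') (d : D ⟶ D')
    (m : A' ⊗ B' ⟶ AB) (n : AB ⊗ D' ⟶ L) (m' : B' ⊗ D' ⟶ BD) (n' : A' ⊗ BD ⟶ R) (e : L ⟶ R)
    (h : (α_ _ _ _).hom ≫ (_ ◁ m') ≫ n' = (m ▷ _) ≫ n ≫ e) :
    (α_ A B D).hom ≫ (a ⊗ₘ ((b ⊗ₘ d) ≫ m')) ≫ n' = ((((a ⊗ₘ b) ≫ m) ⊗ₘ d) ≫ n) ≫ e := by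
  have h₁ : a ⊗ₘ ((b ⊗ₘ d) ≫ m') = (a ⊗ₘ (b ⊗ₘ d)) ≫ (_ ◁ m') := by
    rw [← id_tensorHom, tensorHom_comp_tensorHom, Category.comp_id]
  have h₂ : ((a ⊗ₘ b) ≫ m) ⊗ₘ d = ((a ⊗ₘ b) ⊗ₘ d) ≫ (m ▷ _) := by
    rw [← tensorHom_id, tensorHom_comp_tensorHom, Category.comp_id]
  rw [h₁, h₂]
  simp only [Category.assoc, ← h, associator_naturality_assoc]

theorem powerMul_lu (A : C) (a : ℕ) (h : 0 + a ≤ 1) :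
    (powerMul A 0 a h).hom = (λ_ _).hom ≫ eqToHom (by rw [Nat.zero_add]) := by
  obtain rfl | rfl : a = 0 ∨ a = 1 := by omega
  all_goals exact (Category.comp_id _).symm

theorem powerMul_ru (A : C) (a : ℕ) (h : a + 0 ≤ 1) :
    (powerMul A a 0 h).hom = (ρ_ _).hom := by
  obtain rfl | rfl : a = 0 ∨ a = 1 := by omega
  · exact unitors_equal
  · rfl

theorem powerMul_cast (A : C) {a b a' b' : ℕ} (ha : a = a') (hb : b = b') (h : a + b ≤ 1) :
    (eqToHom (by rw [ha]) ⊗ₘ eqToHom (by rw [hb])) ≫ (powerMul A a' b' (by omega)).hom =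
      (powerMul A a b h).hom ≫ eqToHom (by rw [ha, hb]) := by
  subst ha hb
  simp

theorem collapse_lu {A A' L : C} {p : L = A'} (a : A ⟶ A') {m : 𝟙_ C ⊗ A' ⟶ L}
    (h : m = (λ_ _).hom ≫ eqToHom p.symm) :
    (λ_ A).hom ≫ a = ((𝟙 (𝟙_ C) ⊗ₘ a) ≫ m) ≫ eqToHom p := by
  subst p
  simp [h]

theorem collapse_ru {A A' : C} (a : A ⟶ A') {m : A' ⊗ 𝟙_ C ⟶ A'} (h : m = (ρ_ _).hom) :
    (ρ_ A).hom ≫ a = ((a ⊗ₘ 𝟙 (𝟙_ C)) ≫ m) ≫ eqToHom rfl := by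
  simp [h]

theorem comp_inv_eqToHom {D : Type u} [Category.{v} D] {A B A' B' : D} {e : A ≅ B}
    {a : A ⟶ A'} {b : B ⟶ B'} {p : A' = B'} {q : B' = A'} (h : e.hom ≫ b = a ≫ eqToHom p) : e.inv ≫ a = b ≫ eqToHom q := by
  rw [Iso.inv_comp_eq, reassoc_of% h]
  simp

variable [SymmetricCategory C]

/-- The structural isomorphism denoted by a formal composite. -/
def SHom.eval (w : ℕ → C) : ∀ {X Y : Word}, SHom X Y → (ev w X ⟶ ev w Y)
  | _, _, .id X => 𝟙 (ev w X)
  | _, _, .comp f g => f.eval w ≫ g.eval w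
  | _, _, .tensor f g => f.eval w ⊗ₘ g.eval w
  | _, _, .assoc X Y Z => (α_ (ev w X) (ev w Y) (ev w Z)).hom
  | _, _, .assocInv X Y Z => (α_ (ev w X) (ev w Y) (ev w Z)).inv
  | _, _, .lu X => (λ_ (ev w X)).hom
  | _, _, .luInv X => (λ_ (ev w X)).inv
  | _, _, .ru X => (ρ_ (ev w X)).hom
  | _, _, .ruInv X => (ρ_ (ev w X)).inv
  | _, _, .braid X Y => (β_ (ev w X) (ev w Y)).hom

theorem SHom.eval_naturality {w w' : ℕ → C} (φ : ∀ n, w n ⟶ w' n) {X Y : Word} (f : SHom X Y) :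
    f.eval w ≫ evMap φ Y = evMap φ X ≫ f.eval w' := by
  induction f with
  | id => exact (Category.id_comp _).trans (Category.comp_id _).symm
  | comp f g ihf ihg => simp [eval, ihg, reassoc_of% ihf]
  | tensor f g ihf ihg =>
    change (_ ⊗ₘ _) ≫ (_ ⊗ₘ _) = (_ ⊗ₘ _) ≫ (_ ⊗ₘ _)
    simp only [tensorHom_comp_tensorHom, ihf, ihg]
  | assoc => exact (associator_naturality _ _ _).symm
  | assocInv => exact (associator_inv_naturality _ _ _).symm
  | lu =>
    change (λ_ _).hom ≫ _ = (𝟙 _ ⊗ₘ _) ≫ (λ_ _).hom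
    simp
  | luInv =>
    change (λ_ _).inv ≫ (𝟙 _ ⊗ₘ _) = _ ≫ (λ_ _).inv
    simp
  | ru =>
    change (ρ_ _).hom ≫ _ = (_ ⊗ₘ 𝟙 _) ≫ (ρ_ _).hom
    simp
  | ruInv =>
    change (ρ_ _).inv ≫ (_ ⊗ₘ 𝟙 _) = _ ≫ (ρ_ _).inv
    simp
  | braid => exact (BraidedCategory.braiding_naturality _ _).symm

/-- A word in a product valuation splits as the product of the two words. -/
def split (w w' : ℕ → C) : ∀ X, ev (fun n => w n ⊗ w' n) X ⟶ ev w X ⊗ ev w' X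
  | unit => (λ_ (𝟙_ C)).inv
  | leaf _ => 𝟙 _
  | node X Y => (split w w' X ⊗ₘ split w w' Y) ≫ tensorμ _ _ _ _

instance (X₁ X₂ Y₁ Y₂ : C) : IsIso (tensorμ X₁ X₂ Y₁ Y₂) :=
  ⟨⟨tensorδ X₁ X₂ Y₁ Y₂, by simp, by simp⟩⟩

instance (w w' : ℕ → C) : ∀ X, IsIso (split w w' X)
  | unit => inferInstanceAs (IsIso (λ_ (𝟙_ C)).inv)
  | leaf _ => inferInstanceAs (IsIso (𝟙 _))
  | node X Y => by
    have := instIsIsoSplit w w' X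
    have := instIsIsoSplit w w' Y
    exact inferInstanceAs (IsIso ((split w w' X ⊗ₘ split w w' Y) ≫ tensorμ _ _ _ _))

/-- Symmetry, and not only a braiding, is needed: the inner factors cross twice, and the two
crossings must cancel. -/
theorem braiding_tensorμ (X₁ X₂ Y₁ Y₂ : C) :
    (β_ (X₁ ⊗ X₂) (Y₁ ⊗ Y₂)).hom ≫ tensorμ Y₁ Y₂ X₁ X₂ =
      tensorμ X₁ X₂ Y₁ Y₂ ≫ ((β_ X₁ Y₁).hom ⊗ₘ (β_ X₂ Y₂).hom) := by
  simp [tensorμ, SymmetricCategory.braiding_swap_eq_inv_braiding Y₁ X₂,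
    SymmetricCategory.braiding_swap_eq_inv_braiding Y₂ X₁,
    MonoidalCategory.tensorHom_def]

theorem tensorμ_assoc_of_factors {A B D A₁ B₁ D₁ A₂ B₂ D₂ : C} (a : A ⟶ A₁ ⊗ A₂) (b : B ⟶ B₁ ⊗ B₂)
    (d : D ⟶ D₁ ⊗ D₂) :
    (α_ A B D).hom ≫ (a ⊗ₘ ((b ⊗ₘ d) ≫ tensorμ _ _ _ _)) ≫ tensorμ _ _ _ _ =
      ((((a ⊗ₘ b) ≫ tensorμ _ _ _ _) ⊗ₘ d) ≫ tensorμ _ _ _ _) ≫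
        ((α_ A₁ B₁ D₁).hom ⊗ₘ (α_ A₂ B₂ D₂).hom) := by
  have h₁ : a ⊗ₘ ((b ⊗ₘ d) ≫ tensorμ _ _ _ _) =
      (a ⊗ₘ (b ⊗ₘ d)) ≫ (_ ◁ tensorμ B₁ B₂ D₁ D₂) := by
    rw [← id_tensorHom, tensorHom_comp_tensorHom, Category.comp_id]
  have h₂ : ((a ⊗ₘ b) ≫ tensorμ _ _ _ _) ⊗ₘ d =
      ((a ⊗ₘ b) ⊗ₘ d) ≫ (tensorμ A₁ A₂ B₁ B₂ ▷ _) := by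
    rw [← tensorHom_id, tensorHom_comp_tensorHom, Category.comp_id]
  rw [h₁, h₂]
  simp only [Category.assoc, tensor_associativity, associator_naturality_assoc]

theorem tensorμ_lu_of_factors {A A₁ A₂ : C} (a : A ⟶ A₁ ⊗ A₂) :
    (λ_ A).hom ≫ a = (((λ_ (𝟙_ C)).inv ⊗ₘ a) ≫ tensorμ _ _ _ _) ≫
      ((λ_ A₁).hom ⊗ₘ (λ_ A₂).hom) := by
  rw [MonoidalCategory.tensorHom_def', Category.assoc, Category.assoc, ← tensor_left_unitality,
    leftUnitor_naturality]

theorem tensorμ_ru_of_factors {A A₁ A₂ : C} (a : A ⟶ A₁ ⊗ A₂) :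
    (ρ_ A).hom ≫ a = ((a ⊗ₘ (λ_ (𝟙_ C)).inv) ≫ tensorμ _ _ _ _) ≫
      ((ρ_ A₁).hom ⊗ₘ (ρ_ A₂).hom) := by
  rw [MonoidalCategory.tensorHom_def, Category.assoc, Category.assoc, ← tensor_right_unitality,
    rightUnitor_naturality]

/-- Coherence can be tested one wire at a time because of this: up to the isomorphism `split`,
evaluating at a tensor product of valuations is tensoring the evaluations. -/
theorem SHom.eval_split (w w' : ℕ → C) {X Y : Word} (f : SHom X Y) :
    f.eval (fun n => w n ⊗ w' n) ≫ split w w' Y =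
      split w w' X ≫ (f.eval w ⊗ₘ f.eval w') := by
  induction f with
  | id => simp [eval]
  | comp f g ihf ihg => simp [eval, ihg, reassoc_of% ihf]
  | tensor f g ihf ihg =>
    change (_ ⊗ₘ _) ≫ (_ ⊗ₘ _) ≫ tensorμ _ _ _ _ =
      ((_ ⊗ₘ _) ≫ tensorμ _ _ _ _) ≫ ((_ ⊗ₘ _) ⊗ₘ (_ ⊗ₘ _))
    rw [tensorHom_comp_tensorHom_assoc, ihf, ihg, Category.assoc, ← tensorμ_natural,
      tensorHom_comp_tensorHom_assoc]
  | assoc => exact tensorμ_assoc_of_factors ..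
  | assocInv => exact comp_inv_tensorHom_inv (tensorμ_assoc_of_factors ..)
  | lu => exact tensorμ_lu_of_factors ..
  | luInv => exact comp_inv_tensorHom_inv (tensorμ_lu_of_factors ..)
  | ru => exact tensorμ_ru_of_factors ..
  | ruInv => exact comp_inv_tensorHom_inv (tensorμ_ru_of_factors ..)
  | braid =>
    change (β_ _ _).hom ≫ (_ ⊗ₘ _) ≫ tensorμ _ _ _ _ =
      ((_ ⊗ₘ _) ≫ tensorμ _ _ _ _) ≫ ((β_ _ _).hom ⊗ₘ (β_ _ _).hom)
    rw [Category.assoc, ← braiding_tensorμ, BraidedCategory.braiding_naturality_assoc]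

theorem powerMul_braiding (A : C) (a b : ℕ) (h : a + b ≤ 1) :
    (β_ _ _).hom ≫ (powerMul A b a (by omega)).hom =
      (powerMul A a b h).hom ≫ eqToHom (by rw [Nat.add_comm]) := by
  obtain ⟨rfl, rfl⟩ | ⟨rfl, rfl⟩ | ⟨rfl, rfl⟩ :
    (a = 0 ∧ b = 0) ∨ (a = 1 ∧ b = 0) ∨ (a = 0 ∧ b = 1) := by omega
  · exact (braiding_leftUnitor (𝟙_ C)).trans (unitors_equal.symm.trans (Category.comp_id _).symm)
  · exact (braiding_leftUnitor A).trans (Category.comp_id _).symm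
  · exact (braiding_rightUnitor A).trans (Category.comp_id _).symm

theorem SHom.cnt_eq {X Y : Word} (i : ℕ) (f : SHom X Y) : cnt i X = cnt i Y := by
  rw [cnt_eq_count, cnt_eq_count, f.labels_eq]

/-- After removal of the unit wires at most one wire is left, so there is nothing to permute and
every structural map becomes a transport along an equality of counts. -/
theorem SHom.eval_collapse (i : ℕ) (A : C) {X Y : Word} (f : SHom X Y) (hX : cnt i X ≤ 1) :
    f.eval (single i A) ≫ (collapse i A Y (f.cnt_eq i ▸ hX)).hom =
      (collapse i A X hX).hom ≫ eqToHom (by rw [f.cnt_eq i]) := by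
  induction f with
  | id => simp [eval]
  | comp f g ihf ihg =>
    have hY := f.cnt_eq i ▸ hX
    simp [eval, ihg hY, reassoc_of% (ihf hX)]
  | tensor f g ihf ihg =>
    have h₁ := ihf ((Nat.le_add_right _ _).trans hX)
    have h₂ := ihg ((Nat.le_add_left _ _).trans hX)
    change (_ ⊗ₘ _) ≫ (_ ⊗ₘ _) ≫ (powerMul A _ _ _).hom = ((_ ⊗ₘ _) ≫ (powerMul A _ _ _).hom) ≫ _
    rw [tensorHom_comp_tensorHom_assoc, h₁, h₂, ← tensorHom_comp_tensorHom, Category.assoc]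
    exact (congrArg (_ ≫ ·) (powerMul_cast A (f.cnt_eq i) (g.cnt_eq i) hX)).trans
      (Category.assoc _ _ _).symm
  | assoc => exact collapse_assoc _ _ _ _ _ _ _ _ (powerMul_assoc A _ _ _ hX)
  | assocInv =>
    exact comp_inv_eqToHom (collapse_assoc _ _ _ _ _ _ _ _ (powerMul_assoc A _ _ _
      ((Nat.add_assoc _ _ _).trans_le hX)))
  | lu => exact collapse_lu _ (powerMul_lu A _ hX)
  | luInv =>
    exact comp_inv_eqToHom (p := congrArg (power A) (Nat.zero_add _))
      (collapse_lu _ (powerMul_lu A _ ((Nat.zero_add _).trans_le hX)))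
  | ru => exact collapse_ru _ (powerMul_ru A _ hX)
  | ruInv => exact comp_inv_eqToHom (q := rfl) (collapse_ru _ (powerMul_ru A _ hX))
  | braid =>
    change (β_ _ _).hom ≫ (_ ⊗ₘ _) ≫ (powerMul A _ _ _).hom =
      ((_ ⊗ₘ _) ≫ (powerMul A _ _ _).hom) ≫ _
    rw [← BraidedCategory.braiding_naturality_assoc]
    exact (congrArg (_ ≫ ·) (powerMul_braiding A _ _ hX)).trans (Category.assoc _ _ _).symm

/-- Distinctness of labels is essential: two copies of one wire could be braided, and that braiding
need not be the identity. -/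
theorem SHom.eval_single_eq (i : ℕ) (A : C) {X Y : Word} (hX : X.labels.Nodup) (f g : SHom X Y) :
    f.eval (single i A) = g.eval (single i A) := by
  have h : cnt i X ≤ 1 := cnt_eq_count i X ▸ Multiset.nodup_iff_count_le_one.1 hX i
  rw [← cancel_mono (collapse i A Y (f.cnt_eq i ▸ h)).hom, f.eval_collapse i A h,
    g.eval_collapse i A h]

theorem SHom.eval_eq_of_iso {w w' : ℕ → C} (φ : ∀ n, w n ≅ w' n) {X Y : Word} {f g : SHom X Y}
    (h : f.eval w' = g.eval w') : f.eval w = g.eval w := by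
  rw [← cancel_mono (evMap (fun n => (φ n).hom) Y), eval_naturality, eval_naturality, h]

/-- Coherence: two formal composites between words without repeated wires are equal. -/
theorem SHom.eval_eq {X Y : Word} (hX : X.labels.Nodup) (f g : SHom X Y) :
    ∀ (N : ℕ) (w : ℕ → C), (∀ n, N ≤ n → w n = 𝟙_ C) → f.eval w = g.eval w
  | 0, w, h =>
    -- All wires are units here, so this is a valuation of the one-wire kind whose distinguished
    -- wire is again the unit.
    eval_eq_of_iso (w' := single 0 (𝟙_ C))
      (fun n => eqToIso (by rw [h n n.zero_le]; unfold single power; split <;> rfl))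
      (eval_single_eq 0 _ hX f g)
  | N + 1, w, h => by
    let w' : ℕ → C := fun n => if n = N then 𝟙_ C else w n
    -- Each wire is written as a tensor product with a unit: the left factor keeps only wire `N`,
    -- the right factor all other wires.
    refine eval_eq_of_iso (w' := fun n => single N (w N) n ⊗ w' n) (fun n => ?_) ?_
    · by_cases hn : n = N
      · subst hn
        exact (ρ_ _).symm ≪≫ eqToIso (by simp [w', single, cnt, power])
      · exact (λ_ _).symm ≪≫ eqToIso (by simp [w', single, cnt, power, hn])
    · rw [← cancel_mono (split (single N (w N)) w' Y), eval_split, eval_split,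
        eval_single_eq N _ hX f g, eval_eq hX f g N w']
      intro n hn
      by_cases h' : n = N
      · simp [w', h']
      · simp only [w', h', if_false]
        exact h n (by omega)

end Eval
end Wiring

/-! ### String diagrams, their sequential normal forms and their equality -/

namespace Wiring
open Wiring.Word

section Diagrams

variable {C : Type u} [Category.{v} C] [MonoidalCategory C]

theorem comp_box_assoc {A B R X Y Z : C} (p : X ⟶ A ⊗ R) (h : A ⟶ B) (f : B ⊗ R ⟶ Y) (g : Y ⟶ Z) :
    p ≫ (h ▷ R) ≫ f ≫ g = (p ≫ (h ▷ R) ≫ f) ≫ g := by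
  simp

theorem box_whiskerRight {A B R X Y : C} (p : X ⟶ A ⊗ R) (h : A ⟶ B) (f : B ⊗ R ⟶ Y) (Z : C) :
    ((p ▷ Z) ≫ (α_ _ _ _).hom) ≫ (h ▷ (R ⊗ Z)) ≫ (α_ _ _ _).inv ≫ (f ▷ Z) =
      (p ≫ (h ▷ R) ≫ f) ▷ Z := by
  simp

theorem box_whisker_exchange {A B R S X Y : C} (p : X ⟶ A ⊗ R) (h : A ⟶ B) (s : R ⟶ S)
    (g : B ⊗ S ⟶ Y) :
    p ≫ (h ▷ R) ≫ (B ◁ s) ≫ g = (p ≫ (A ◁ s)) ≫ (h ▷ S) ≫ g := by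
  rw [Category.assoc, whisker_exchange_assoc]

variable [SymmetricCategory C]

/-- The valuation given by a finite list of objects. -/
def val (L : List C) : ℕ → C := fun n => L.getD n (𝟙_ C)

/-- A morphism denoted by a formal composite of structural isomorphisms. -/
def IsStr (L : List C) (X Y : Word) (f : ev (val L) X ⟶ ev (val L) Y) : Prop :=
  ∃ t : SHom X Y, t.eval (val L) = f

variable {L : List C}

theorem IsStr.id (X : Word) : IsStr L X X (𝟙 _) := ⟨.id X, rfl⟩

theorem IsStr.comp {X Y Z : Word} {f : ev (val L) X ⟶ ev (val L) Y} {g : ev (val L) Y ⟶ ev (val L) Z}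
    (hf : IsStr L X Y f) (hg : IsStr L Y Z g) : IsStr L X Z (f ≫ g) := by
  obtain ⟨s, rfl⟩ := hf
  obtain ⟨t, rfl⟩ := hg
  exact ⟨s.comp t, rfl⟩

theorem IsStr.whiskerLeft (Z : Word) {X Y : Word} {f : ev (val L) X ⟶ ev (val L) Y}
    (hf : IsStr L X Y f) : IsStr L (node Z X) (node Z Y) (ev (val L) Z ◁ f) := by
  obtain ⟨s, rfl⟩ := hf
  exact ⟨(SHom.id Z).tensor s, id_tensorHom _ _⟩

theorem IsStr.whiskerRight (Z : Word) {X Y : Word} {f : ev (val L) X ⟶ ev (val L) Y}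
    (hf : IsStr L X Y f) : IsStr L (node X Z) (node Y Z) (f ▷ ev (val L) Z) := by
  obtain ⟨s, rfl⟩ := hf
  exact ⟨s.tensor (SHom.id Z), tensorHom_id _ _⟩

theorem IsStr.labels_eq {X Y : Word} {f : ev (val L) X ⟶ ev (val L) Y} (hf : IsStr L X Y f) :
    X.labels = Y.labels :=
  hf.choose.labels_eq

theorem IsStr.eq {X Y : Word} (hX : X.labels.Nodup) {f g : ev (val L) X ⟶ ev (val L) Y}
    (hf : IsStr L X Y f) (hg : IsStr L X Y g) : f = g := by
  obtain ⟨s, rfl⟩ := hf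
  obtain ⟨t, rfl⟩ := hg
  exact SHom.eval_eq hX s t L.length _ fun n hn => List.getD_eq_default _ _ hn

theorem exists_isStr {X Y : Word} (h : X.labels = Y.labels) : ∃ f, IsStr L X Y f :=
  (nonempty_of_labels_eq h).elim fun t => ⟨_, t, rfl⟩

/-- Exchange of the first two of three factors. -/
def swapFront (A B D : C) : A ⊗ (B ⊗ D) ⟶ B ⊗ (A ⊗ D) :=
  (α_ A B D).inv ≫ ((β_ A B).hom ▷ D) ≫ (α_ B A D).hom

theorem swapFront_naturality {A B D A' B' D' : C} (f : A ⟶ A') (g : B ⟶ B') (h : D ⟶ D') :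
    (f ⊗ₘ (g ⊗ₘ h)) ≫ swapFront A' B' D' = swapFront A B D ≫ (g ⊗ₘ (f ⊗ₘ h)) := by
  unfold swapFront
  rw [associator_inv_naturality_assoc, ← tensorHom_id, tensorHom_comp_tensorHom_assoc,
    BraidedCategory.braiding_naturality, Category.comp_id, Category.assoc, Category.assoc,
    ← associator_naturality, ← tensorHom_id, tensorHom_comp_tensorHom_assoc, Category.id_comp]

theorem swapFront_swapFront (A B D : C) : swapFront A B D ≫ swapFront B A D = 𝟙 _ := by
  simp [swapFront, SymmetricCategory.braiding_swap_eq_inv_braiding B A]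

/-- This is the interchange law for two boxes with disjoint inputs; `swapFront` brings each of them
to the first position in turn. -/
theorem box_exchange {A A' B B' R S T X Y : C} (p : X ⟶ A ⊗ S) (f : A ⟶ A') (g : B ⟶ B')
    (s : S ⟶ B ⊗ R) (t : A' ⊗ R ⟶ T) (q : B' ⊗ T ⟶ Y) :
    p ≫ (f ▷ S) ≫ ((A' ◁ s) ≫ swapFront A' B R ≫ (B ◁ t)) ≫ (g ▷ T) ≫ q =
      (p ≫ (A ◁ s) ≫ swapFront A B R) ≫ (g ▷ (A ⊗ R)) ≫ swapFront B' A R ≫ (f ▷ (B' ⊗ R)) ≫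
        (swapFront A' B' R ≫ (B' ◁ t)) ≫ q := by
  have h₁ : swapFront A B R ≫ (g ▷ (A ⊗ R)) = (A ◁ (g ▷ R)) ≫ swapFront A B' R := by
    simpa using (swapFront_naturality (𝟙 A) g (𝟙 R)).symm
  have h₂ : (A' ◁ (g ▷ R)) ≫ swapFront A' B' R = swapFront A' B R ≫ (g ▷ (A' ⊗ R)) := by
    simpa using swapFront_naturality (𝟙 A') g (𝟙 R)
  simp only [Category.assoc]
  rw [reassoc_of% h₁, reassoc_of% (swapFront_swapFront A B' R), whisker_exchange_assoc,
    whisker_exchange_assoc, whisker_exchange_assoc, reassoc_of% h₂]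

theorem isStr_swapFront (X Y Z : Word) :
    IsStr L (node X (node Y Z)) (node Y (node X Z))
      (swapFront (ev (val L) X) (ev (val L) Y) (ev (val L) Z)) :=
  IsStr.comp ⟨.assocInv X Y Z, rfl⟩ (IsStr.comp (IsStr.whiskerRight Z ⟨.braid X Y, rfl⟩)
    ⟨.assoc Y X Z, rfl⟩)

variable (L) in
/-- A morphism with labelled input and output wires. -/
structure Box where
  dom : Word
  cod : Word
  hom : ev (val L) dom ⟶ ev (val L) cod

/-- The wires produced by a list of boxes. -/
def outs (l : List (Box L)) : Multiset ℕ := (l.map fun b => b.cod.labels).sum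

variable (L) in
/-- Sequential normal forms: boxes applied one at a time to the first factor, with structural
isomorphisms in between. -/
inductive IsSeq : List (Box L) → ∀ X Y : Word, (ev (val L) X ⟶ ev (val L) Y) → Prop
  | str {X Y f} : IsStr L X Y f → IsSeq [] X Y f
  | cons {l X Y R} (b : Box L) {p : ev (val L) X ⟶ ev (val L) (node b.dom R)}
      {g : ev (val L) (node b.cod R) ⟶ ev (val L) Y} :
      IsStr L X (node b.dom R) p → IsSeq l (node b.cod R) Y g →
      IsSeq (b :: l) X Y (p ≫ (b.hom ▷ ev (val L) R) ≫ g)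

theorem IsSeq.comp_left {l : List (Box L)} {X Y Z : Word} {f : ev (val L) X ⟶ ev (val L) Y}
    {g : ev (val L) Y ⟶ ev (val L) Z} (hf : IsStr L X Y f) (hg : IsSeq L l Y Z g) :
    IsSeq L l X Z (f ≫ g) := by
  cases hg with
  | str h => exact .str (hf.comp h)
  | cons b hp hg =>
    rw [← Category.assoc]
    exact .cons b (hf.comp hp) hg

theorem IsSeq.comp {l l' : List (Box L)} {X Y Z : Word} {f : ev (val L) X ⟶ ev (val L) Y}
    {g : ev (val L) Y ⟶ ev (val L) Z} (hf : IsSeq L l X Y f) (hg : IsSeq L l' Y Z g) :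
    IsSeq L (l ++ l') X Z (f ≫ g) := by
  induction hf with
  | str h => exact hg.comp_left h
  | cons b hp _ ih =>
    refine cast (congrArg _ ?_) (IsSeq.cons b hp (ih hg))
    exact comp_box_assoc _ _ _ _

theorem IsSeq.whiskerRight (Z : Word) {l : List (Box L)} {X Y : Word}
    {f : ev (val L) X ⟶ ev (val L) Y} (hf : IsSeq L l X Y f) :
    IsSeq L l (node X Z) (node Y Z) (f ▷ ev (val L) Z) := by
  induction hf with
  | str h => exact .str (h.whiskerRight Z)
  | @cons l X Y R b p g hp _ ih =>
    have h₁ := (hp.whiskerRight Z).comp ⟨.assoc _ _ _, rfl⟩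
    have h₂ := ih.comp_left ⟨.assocInv _ _ _, rfl⟩
    have := IsSeq.cons b h₁ h₂
    refine cast (congrArg _ ?_) this
    exact box_whiskerRight _ _ _ _

theorem IsSeq.whiskerLeft (Z : Word) {l : List (Box L)} {X Y : Word}
    {f : ev (val L) X ⟶ ev (val L) Y} (hf : IsSeq L l X Y f) :
    IsSeq L l (node Z X) (node Z Y) (ev (val L) Z ◁ f) := by
  have := ((hf.whiskerRight Z).comp_left ⟨.braid Z X, rfl⟩).comp (.str ⟨.braid Y Z, rfl⟩)
  rw [List.append_nil] at this
  refine cast (congrArg _ ?_) this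
  change ((β_ _ _).hom ≫ (f ▷ _)) ≫ (β_ _ _).hom = _
  rw [← BraidedCategory.braiding_naturality_right, Category.assoc, SymmetricCategory.symmetry,
    Category.comp_id]

theorem IsSeq.box (b : Box L) : IsSeq L [b] b.dom b.cod b.hom := by
  have := IsSeq.cons (R := unit) b ⟨.ruInv _, rfl⟩ (.str ⟨.ru _, rfl⟩)
  refine cast (congrArg _ ?_) this
  change (ρ_ _).inv ≫ (b.hom ▷ 𝟙_ C) ≫ (ρ_ _).hom = _
  simp

theorem IsSeq.dom_subset {l : List (Box L)} {X Y : Word} {g : ev (val L) X ⟶ ev (val L) Y}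
    (hg : IsSeq L l X Y g) {b : Box L} (hb : b ∈ l) {n : ℕ} (hn : n ∈ b.dom.labels) :
    n ∈ X.labels + outs l := by
  induction hg with
  | str => simp at hb
  | cons c hp _ ih =>
    have := hp.labels_eq
    rcases List.mem_cons.1 hb with rfl | hb
    · simp [this, labels, hn]
    · have := ih hb
      simp only [outs, labels, Multiset.mem_add, List.map_cons, List.sum_cons] at this ⊢
      simp_all [labels]
      tauto

/-- A box whose inputs are available can be applied first. -/
theorem IsSeq.exists_front {l : List (Box L)} {X Y : Word} {g : ev (val L) X ⟶ ev (val L) Y}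
    (hg : IsSeq L l X Y g) {b : Box L} (hb : b ∈ l) (hbX : b.dom.labels ⊆ X.labels)
    (hl : (X.labels + outs l).Nodup) :
    ∃ (l₀ : List (Box L)) (R : Word) (p : ev (val L) X ⟶ ev (val L) (node b.dom R))
      (g₀ : ev (val L) (node b.cod R) ⟶ ev (val L) Y),
      l.Perm (b :: l₀) ∧ IsStr L X (node b.dom R) p ∧ IsSeq L l₀ (node b.cod R) Y g₀ ∧
        g = p ≫ (b.hom ▷ ev (val L) R) ≫ g₀ := by
  induction hg with
  | str => simp at hb
  | @cons l X Y S c p g hp hg ih =>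
    rcases List.mem_cons.1 hb with rfl | hb
    · exact ⟨l, S, p, g, .refl _, hp, hg, rfl⟩
    have hX : X.labels = c.dom.labels + S.labels := hp.labels_eq
    have ho : outs (c :: l) = c.cod.labels + outs l := by simp [outs]
    have hl' : (c.dom.labels + (c.cod.labels + S.labels + outs l)).Nodup := by
      convert hl using 1
      rw [hX, ho]
      abel
    -- An input of `b` is already a wire of `X`. As labels are distinct, it is produced neither by
    -- `c` nor by a later box, so it bypasses `c`.
    have hbS : b.dom.labels ⊆ S.labels := by
      intro n hn
      have h₁ := hbX hn
      have h₂ := hg.dom_subset hb hn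
      rw [ho, Multiset.nodup_add] at hl
      have h₃ := Multiset.disjoint_left.1 hl.2.2 h₁
      simp only [labels, Multiset.mem_add, not_or] at h₂ h₃
      tauto
    obtain ⟨l₀, R₁, p₁, g₀, hlp, hp₁, hg₀, rfl⟩ := ih hb
      (fun n hn => Multiset.mem_add.2 (.inr (hbS hn))) (Multiset.nodup_add.1 hl').2.1
    have hlab : c.cod.labels + S.labels = b.dom.labels + R₁.labels := hp₁.labels_eq
    have hnd : (node c.cod S).labels.Nodup :=
      (Multiset.nodup_add.1 (Multiset.nodup_add.1 hl').2.1).1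
    have hbn : b.dom.labels.Nodup := by
      have := hp₁.labels_eq ▸ hnd
      exact (Multiset.nodup_add.1 this).1
    obtain ⟨r, hr⟩ := Multiset.le_iff_exists_add.1 ((Multiset.le_iff_subset hbn).2 hbS)
    let R := ofList r.toList
    have hR : R.labels = r := by simp [R, labels_ofList]
    obtain ⟨s, hs⟩ := exists_isStr (L := L) (X := S) (Y := node b.dom R) (by simp [labels, hR, hr])
    obtain ⟨t, ht⟩ := exists_isStr (L := L) (X := node c.cod R) (Y := R₁) (by
      rw [hr] at hlab
      simp only [labels, hR]
      apply add_left_cancel (a := b.dom.labels)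
      rw [← hlab]
      abel)
    -- By coherence the rewiring between `c` and `b` may be assumed to fix the outputs of `c`, apart
    -- from one exchange; this is the form in which the two boxes commute.
    have hp₁' : p₁ = (ev (val L) c.cod ◁ s) ≫ swapFront _ _ _ ≫ (ev (val L) b.dom ◁ t) :=
      hp₁.eq hnd ((hs.whiskerLeft _).comp ((isStr_swapFront _ _ _).comp (ht.whiskerLeft _)))
    refine ⟨c :: l₀, node c.dom R, p ≫ (ev (val L) c.dom ◁ s) ≫ swapFront _ _ _,
      swapFront _ _ _ ≫ (c.hom ▷ ev (val L) (node b.cod R)) ≫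
        ((swapFront _ _ _ ≫ (ev (val L) b.cod ◁ t)) ≫ g₀),
      (hlp.cons c).trans (.swap _ _ _), hp.comp ((hs.whiskerLeft _).comp (isStr_swapFront _ _ _)),
      .cons c (isStr_swapFront _ _ _)
        (hg₀.comp_left ((isStr_swapFront _ _ _).comp (ht.whiskerLeft _))), ?_⟩
    subst hp₁'
    exact box_exchange p c.hom b.hom s t g₀

/-- String diagrams with pairwise distinct wires and the same boxes are equal. -/
theorem IsSeq.eq {l : List (Box L)} {X Y : Word} {f : ev (val L) X ⟶ ev (val L) Y}
    (hf : IsSeq L l X Y f) : ∀ {l' : List (Box L)} {g : ev (val L) X ⟶ ev (val L) Y},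
    IsSeq L l' X Y g → l.Perm l' → (X.labels + outs l).Nodup → f = g := by
  induction hf with
  | str h =>
    intro l' g hg hl hX
    obtain rfl := hl.nil_eq
    cases hg with
    | str hg => exact h.eq (Multiset.nodup_add.1 hX).1 hg
  | @cons l X Y R b p f hp hf ih =>
    intro l' g hg hl hX
    have hXl : X.labels = b.dom.labels + R.labels := hp.labels_eq
    have ho : outs (b :: l) = outs l' := (hl.map _).sum_eq
    have ho' : outs (b :: l) = b.cod.labels + outs l := by simp [outs]
    obtain ⟨l₀, R', p', g₀, hl', hp', hg₀, rfl⟩ := hg.exists_front (hl.subset List.mem_cons_self)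
      (hXl ▸ Multiset.subset_of_le (Multiset.le_add_right _ _)) (ho ▸ hX)
    have hR : R.labels = R'.labels := add_left_cancel (hXl.symm.trans hp'.labels_eq)
    -- The wires passing by `b` agree as multisets but may be ordered and bracketed differently; `s`
    -- translates between the two.
    obtain ⟨s, hs⟩ := exists_isStr (L := L) hR
    have hps : p' = p ≫ (ev (val L) b.dom ◁ s) :=
      hp'.eq (Multiset.nodup_add.1 hX).1 (hp.comp (hs.whiskerLeft _))
    have hfg := ih (hg₀.comp_left (hs.whiskerLeft _)) ((hl.trans hl').cons_inv) (by
      have : (b.dom.labels + (b.cod.labels + R.labels + outs l)).Nodup := by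
        convert hX using 1
        rw [hXl, ho']
        abel
      exact (Multiset.nodup_add.1 this).2.1)
    subst hps
    rw [hfg]
    exact box_whisker_exchange p b.hom s g₀

/-- Recognition of string diagrams: `f` is a string diagram from `X` to `Y` with the given boxes. -/
inductive IsDiagram (L : List C) : List (Box L) → Word → Word → ∀ {A B : C}, (A ⟶ B) → Prop
  | box (b : Box L) : IsDiagram L [b] b.dom b.cod b.hom
  | comp {l l' X Y Z} {A B D : C} {f : A ⟶ B} {g : B ⟶ D} :
      IsDiagram L l X Y f → IsDiagram L l' Y Z g → IsDiagram L (l ++ l') X Z (f ≫ g)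
  | tensorHom {l l' X Y X' Y'} {A B A' B' : C} {f : A ⟶ B} {g : A' ⟶ B'} :
      IsDiagram L l X Y f → IsDiagram L l' X' Y' g →
      IsDiagram L (l ++ l') (node X X') (node Y Y') (f ⊗ₘ g)
  | whiskerRight {l X Y Z} {A B D : C} {f : A ⟶ B} :
      IsDiagram L l X Y f → ev (val L) Z = D → IsDiagram L l (node X Z) (node Y Z) (f ▷ D)
  | whiskerLeft {l X Y Z} {A B D : C} {f : A ⟶ B} :
      IsDiagram L l X Y f → ev (val L) Z = D → IsDiagram L l (node Z X) (node Z Y) (D ◁ f)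
  | id {X} {A : C} : ev (val L) X = A → IsDiagram L [] X X (𝟙 A)
  | assoc {X Y Z} {A B D : C} : ev (val L) X = A → ev (val L) Y = B → ev (val L) Z = D →
      IsDiagram L [] (node (node X Y) Z) (node X (node Y Z)) (α_ A B D).hom
  | assocInv {X Y Z} {A B D : C} : ev (val L) X = A → ev (val L) Y = B → ev (val L) Z = D →
      IsDiagram L [] (node X (node Y Z)) (node (node X Y) Z) (α_ A B D).inv
  | lu {X} {A : C} : ev (val L) X = A → IsDiagram L [] (node unit X) X (λ_ A).hom
  | luInv {X} {A : C} : ev (val L) X = A → IsDiagram L [] X (node unit X) (λ_ A).inv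
  | ru {X} {A : C} : ev (val L) X = A → IsDiagram L [] (node X unit) X (ρ_ A).hom
  | ruInv {X} {A : C} : ev (val L) X = A → IsDiagram L [] X (node X unit) (ρ_ A).inv
  | braid {X Y} {A B : C} : ev (val L) X = A → ev (val L) Y = B →
      IsDiagram L [] (node X Y) (node Y X) (β_ A B).hom

/-- Instances of this are placed in the local context before `diagram_eq` is called, which declares
the boxes and labels their wires by positions in `L`. -/
theorem IsDiagram.of (L : List C) (X Y : Word) (f : ev (val L) X ⟶ ev (val L) Y) :
    IsDiagram L [⟨X, Y, f⟩] X Y f :=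
  .box ⟨X, Y, f⟩

/-- Recognition leaves the objects of the morphism free and compares them with evaluated words only
by equations, so that it can follow the syntax; the normal form is recovered after transport. -/
theorem IsDiagram.isSeq {l : List (Box L)} {X Y : Word} {A B : C} {f : A ⟶ B}
    (hf : IsDiagram L l X Y f) :
    ∃ (hA : ev (val L) X = A) (hB : ev (val L) Y = B),
      IsSeq L l X Y (eqToHom hA ≫ f ≫ eqToHom hB.symm) := by
  induction hf with
  | box b => exact ⟨rfl, rfl, by simpa using IsSeq.box b⟩
  | comp _ _ ihf ihg =>
    obtain ⟨rfl, rfl, hf⟩ := ihf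
    obtain ⟨_, rfl, hg⟩ := ihg
    exact ⟨rfl, rfl, by simpa using hf.comp hg⟩
  | @tensorHom _ _ _ Y X' _ _ _ _ _ _ _ _ _ ihf ihg =>
    obtain ⟨rfl, rfl, hf⟩ := ihf
    obtain ⟨rfl, rfl, hg⟩ := ihg
    simp only [eqToHom_refl, Category.id_comp, Category.comp_id] at hf hg
    refine ⟨rfl, rfl, cast (congrArg _ ?_) ((hf.whiskerRight X').comp (hg.whiskerLeft Y))⟩
    exact (MonoidalCategory.tensorHom_def _ _).symm.trans
      ((Category.id_comp _).trans (Category.comp_id _)).symm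
  | whiskerRight _ h ih =>
    obtain ⟨rfl, rfl, hf⟩ := ih
    subst h
    simp only [eqToHom_refl, Category.id_comp, Category.comp_id] at hf
    exact ⟨rfl, rfl, cast (congrArg _ ((Category.id_comp _).trans (Category.comp_id _)).symm)
      (hf.whiskerRight _)⟩
  | whiskerLeft _ h ih =>
    obtain ⟨rfl, rfl, hf⟩ := ih
    subst h
    simp only [eqToHom_refl, Category.id_comp, Category.comp_id] at hf
    exact ⟨rfl, rfl, cast (congrArg _ ((Category.id_comp _).trans (Category.comp_id _)).symm)
      (hf.whiskerLeft _)⟩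
  | id h =>
    subst h
    exact ⟨rfl, rfl, .str ⟨.id _, ((Category.id_comp _).trans (Category.comp_id _)).symm⟩⟩
  | assoc h h' h'' =>
    subst h h' h''
    exact ⟨rfl, rfl, .str ⟨.assoc _ _ _, ((Category.id_comp _).trans (Category.comp_id _)).symm⟩⟩
  | assocInv h h' h'' =>
    subst h h' h''
    exact ⟨rfl, rfl, .str ⟨.assocInv _ _ _, ((Category.id_comp _).trans (Category.comp_id _)).symm⟩⟩
  | lu h =>
    subst h
    exact ⟨rfl, rfl, .str ⟨.lu _, ((Category.id_comp _).trans (Category.comp_id _)).symm⟩⟩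
  | luInv h =>
    subst h
    exact ⟨rfl, rfl, .str ⟨.luInv _, ((Category.id_comp _).trans (Category.comp_id _)).symm⟩⟩
  | ru h =>
    subst h
    exact ⟨rfl, rfl, .str ⟨.ru _, ((Category.id_comp _).trans (Category.comp_id _)).symm⟩⟩
  | ruInv h =>
    subst h
    exact ⟨rfl, rfl, .str ⟨.ruInv _, ((Category.id_comp _).trans (Category.comp_id _)).symm⟩⟩
  | braid h h' =>
    subst h h'
    exact ⟨rfl, rfl, .str ⟨.braid _ _, ((Category.id_comp _).trans (Category.comp_id _)).symm⟩⟩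

/-- Two string diagrams with pairwise distinct wires and the same boxes are equal. The boxes that
occur in the diagrams are taken from the local context. -/
theorem diagram_eq (L : List C) (X Y : Word) {A B : C} {f g : A ⟶ B} {l l' : List (Box L)}
    (hf : IsDiagram L l X Y f := by repeat' first | rfl | assumption | constructor)
    (hg : IsDiagram L l' X Y g := by repeat' first | rfl | assumption | constructor)
    (hl : l.Perm l' := by
      first
        | exact List.Perm.refl _
        | exact Multiset.coe_eq_coe.1 (by simp only [← Multiset.coe_add, Multiset.coe_nil]; abel))
    (hX : (X.labels + outs l).Nodup := by exact of_decide_eq_true rfl) : f = g := by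
  obtain ⟨rfl, rfl, h⟩ := hf.isSeq
  obtain ⟨_, _, h'⟩ := hg.isSeq
  simpa using h.eq h' hl hX

end Diagrams

instance (n : ℕ) : OfNat Word n := ⟨leaf n⟩

end Wiring

/-! ### Equality of morphisms up to feedback -/

section Feedback

open Wiring

local infixr:70 "⬝" => Wiring.Word.node

variable {C : Type u} [Category.{v} C] [MonoidalCategory C] [SymmetricCategory C]

theorem Part.eq_some_of_some_le {α : Type*} {a : α} {x : Part α} (h : Part.some a ≤ x) :
    x = Part.some a :=
  Part.eq_some_iff.2 (h a (Part.mem_some a))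

namespace PartialTrace

variable (T : PartialTrace C)

theorem tr_comp {A B A' B' U : C} {f : A ⊗ U ⟶ B ⊗ U} {t : A ⟶ B} (h : T.tr U f = Part.some t)
    (g : A' ⟶ A) (k : B ⟶ B') :
    T.tr U ((g ▷ U) ≫ f ≫ (k ▷ U)) = Part.some (g ≫ t ≫ k) := by
  have := T.naturality f g k
  rw [h, Part.map_some] at this
  exact Part.eq_some_of_some_le this

theorem tr_whiskerLeft {A B U : C} {f : A ⊗ U ⟶ B ⊗ U} {t : A ⟶ B} (h : T.tr U f = Part.some t)
    (R : C) :
    T.tr U ((α_ R A U).hom ≫ (R ◁ f) ≫ (α_ R B U).inv) = Part.some (R ◁ t) := by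
  have := T.strength f (𝟙 R)
  rw [h, Part.map_some] at this
  simpa only [id_tensorHom] using Part.eq_some_of_some_le this

/-- The wire `U` leads from the output of `a` around the loop to the input of `b`. -/
def yank {X Y Z U : C} (a : X ⟶ Y ⊗ U) (b : Y ⊗ U ⟶ Z) : X ⊗ U ⟶ Z ⊗ U :=
  (a ▷ U) ≫ ((α_ Y U U).hom ≫ (Y ◁ (β_ U U).hom) ≫ (α_ Y U U).inv) ≫ (b ▷ U)

/-- Strength carries the yanking axiom past `Y`, and naturality then adds `a` and `b`. Since yanking
is defined, so is this trace: it is the basic source of definedness. -/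
theorem tr_yank {X Y Z U : C} (a : X ⟶ Y ⊗ U) (b : Y ⊗ U ⟶ Z) :
    T.tr U (yank a b) = Part.some (a ≫ b) := by
  simpa [yank] using T.tr_comp (T.tr_whiskerLeft (T.yanking U) Y) a b

/-- A morphism as a morphism with feedback along the unit. -/
def hat {X Y : C} (f : X ⟶ Y) : X ⊗ 𝟙_ C ⟶ Y ⊗ 𝟙_ C := f ▷ 𝟙_ C

theorem tr_hat {X Y : C} (f : X ⟶ Y) : T.tr (𝟙_ C) (hat f) = Part.some f := by
  rw [T.vanishing_one]
  simp [hat]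

/-- Equality up to sliding along the feedback wires and evaluation of partial traces. -/
inductive LoopEq {X Y : C} : ∀ {U V : C}, (X ⊗ U ⟶ Y ⊗ U) → (X ⊗ V ⟶ Y ⊗ V) → Prop
  | symm {U V : C} {f : X ⊗ U ⟶ Y ⊗ U} {g : X ⊗ V ⟶ Y ⊗ V} : LoopEq f g → LoopEq g f
  | trans {U V W : C} {f : X ⊗ U ⟶ Y ⊗ U} {g : X ⊗ V ⟶ Y ⊗ V} {h : X ⊗ W ⟶ Y ⊗ W} :
      LoopEq f g → LoopEq g h → LoopEq f h
  | slide {U V : C} (f : X ⊗ U ⟶ Y ⊗ V) (g : V ⟶ U) : LoopEq (f ≫ (Y ◁ g)) ((X ◁ g) ≫ f)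
  | tr {U V : C} (f : (X ⊗ U) ⊗ V ⟶ (Y ⊗ U) ⊗ V) (g : X ⊗ U ⟶ Y ⊗ U) :
      T.tr V f = Part.some g → LoopEq ((α_ X U V).inv ≫ f ≫ (α_ Y U V).hom) g

variable {T}

/-- Sliding is dinaturality, evaluation is the second vanishing axiom; the latter requires the inner
trace to be defined, and the generator records just that. -/
theorem LoopEq.tr_eq {X Y U V : C} {f : X ⊗ U ⟶ Y ⊗ U} {g : X ⊗ V ⟶ Y ⊗ V} (h : T.LoopEq f g) :
    T.tr U f = T.tr V g := by
  induction h with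
  | symm _ ih => exact ih.symm
  | trans _ _ ih ih' => exact ih.trans ih'
  | slide f g => exact T.dinaturality f g
  | @tr U V f g h =>
    obtain ⟨hd, hg⟩ := Part.eq_some_iff.1 h
    rw [← T.vanishing_two f hd, hg]

/-- Sliding an isomorphism all the way around the loop allows feedback wires to be reordered,
rebracketed and freed of units. -/
theorem LoopEq.conj {X Y U V : C} {f : X ⊗ U ⟶ Y ⊗ U} {g : X ⊗ V ⟶ Y ⊗ V} (e : U ≅ V)
    (h : f ≫ (Y ◁ e.hom) = (X ◁ e.hom) ≫ g) : T.LoopEq f g := by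
  have := LoopEq.slide (T := T) (g ≫ (Y ◁ e.inv)) e.hom
  rw [← reassoc_of% h] at this
  simpa using this.symm

theorem LoopEq.refl {X Y U : C} (f : X ⊗ U ⟶ Y ⊗ U) : T.LoopEq f f :=
  .conj (Iso.refl U) (by simp)

/-- A unit feedback wire is added on the outside, so that the whole of `U` becomes an inner trace
that can be evaluated. -/
theorem loopEq_hat {X Y U : C} {f : X ⊗ U ⟶ Y ⊗ U} {g : X ⟶ Y} (h : T.tr U f = Part.some g) :
    T.LoopEq f (hat g) := by
  have h₁ : T.tr U (((ρ_ X).hom ▷ U) ≫ f ≫ ((ρ_ Y).inv ▷ U)) = Part.some (hat g) := by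
    rw [T.tr_comp h]
    simp [hat]
  refine .trans (.conj (λ_ U).symm ?_) (.tr _ _ h₁)
  simp

theorem LoopEq.tr_eq_some {X Y U : C} {f : X ⊗ U ⟶ Y ⊗ U} {g : X ⟶ Y} (h : T.LoopEq f (hat g)) :
    T.tr U f = Part.some g :=
  h.tr_eq.trans (T.tr_hat g)

/-- A context: `m` is preceded by `a` and followed by `b`, which use a further feedback wire `E`,
and a wire `R` passes by `m`. -/
def ctx {X Y X' Y' E R U V : C} (a : X' ⊗ E ⟶ X ⊗ R) (b : Y ⊗ R ⟶ Y' ⊗ E) (m : X ⊗ U ⟶ Y ⊗ V) :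
    X' ⊗ (U ⊗ E) ⟶ Y' ⊗ (V ⊗ E) :=
  (X' ◁ (β_ U E).hom) ≫ (α_ X' E U).inv ≫ (a ▷ U) ≫ (α_ X R U).hom ≫ (X ◁ (β_ R U).hom) ≫
    (α_ X U R).inv ≫ (m ▷ R) ≫ (α_ Y V R).hom ≫ (Y ◁ (β_ V R).hom) ≫ (α_ Y R V).inv ≫ (b ▷ V) ≫
    (α_ Y' E V).hom ≫ (Y' ◁ (β_ E V).hom)

theorem ctx_comp {X Y X' Y' E R U V W : C} (a : X' ⊗ E ⟶ X ⊗ R) (b : Y ⊗ R ⟶ Y' ⊗ E)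
    (m : X ⊗ U ⟶ Y ⊗ V) (g : V ⟶ W) :
    ctx a b (m ≫ (Y ◁ g)) = ctx a b m ≫ (Y' ◁ (g ▷ E)) := by
  let L := [X', E, U, X, R, Y, V, Y', E, W]
  have := IsDiagram.of L (0⬝1) (3⬝4) a
  have := IsDiagram.of L (5⬝4) (7⬝8) b
  have := IsDiagram.of L (3⬝2) (5⬝6) m
  have := IsDiagram.of L 6 9 g
  exact diagram_eq L (0⬝2⬝1) (7⬝9⬝8)

theorem comp_ctx {X Y X' Y' E R U V W : C} (a : X' ⊗ E ⟶ X ⊗ R) (b : Y ⊗ R ⟶ Y' ⊗ E)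
    (m : X ⊗ U ⟶ Y ⊗ V) (g : W ⟶ U) :
    ctx a b ((X ◁ g) ≫ m) = (X' ◁ (g ▷ E)) ≫ ctx a b m := by
  let L := [X', E, U, X, R, Y, V, Y', E, W]
  have := IsDiagram.of L (0⬝1) (3⬝4) a
  have := IsDiagram.of L (5⬝4) (7⬝8) b
  have := IsDiagram.of L (3⬝2) (5⬝6) m
  have := IsDiagram.of L 9 2 g
  exact diagram_eq L (0⬝9⬝1) (7⬝6⬝8)

/-- The congruence property that Kleene equality of traces lacks. Slides remain slides, and an
evaluated trace is defined, so strength and naturality carry it through the context. -/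
theorem LoopEq.ctx {X Y X' Y' E R U V : C} (a : X' ⊗ E ⟶ X ⊗ R) (b : Y ⊗ R ⟶ Y' ⊗ E)
    {f : X ⊗ U ⟶ Y ⊗ U} {g : X ⊗ V ⟶ Y ⊗ V} (h : T.LoopEq f g) :
    T.LoopEq (ctx a b f) (ctx a b g) := by
  induction h with
  | symm _ ih => exact ih.symm
  | trans _ _ ih ih' => exact ih.trans ih'
  | slide f g =>
    rw [ctx_comp, comp_ctx]
    exact .slide _ _
  | @tr U V f g h =>
    let P : X' ⊗ (U ⊗ E) ⟶ R ⊗ (X ⊗ U) := (X' ◁ (β_ U E).hom) ≫ (α_ X' E U).inv ≫ (a ▷ U) ≫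
      ((β_ X R).hom ▷ U) ≫ (α_ R X U).hom
    let Q : R ⊗ (Y ⊗ U) ⟶ Y' ⊗ (U ⊗ E) := (α_ R Y U).inv ≫ ((β_ R Y).hom ▷ U) ≫ (b ▷ U) ≫
      (α_ Y' E U).hom ≫ (Y' ◁ (β_ E U).hom)
    have hg : P ≫ (R ◁ g) ≫ Q = PartialTrace.ctx a b g := by
      let L := [X', E, U, X, R, Y, U, Y', E]
      have := IsDiagram.of L (0⬝1) (3⬝4) a
      have := IsDiagram.of L (5⬝4) (7⬝8) b
      have := IsDiagram.of L (3⬝2) (5⬝6) g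
      exact diagram_eq L (0⬝2⬝1) (7⬝6⬝8)
    have ht := T.tr_comp (T.tr_whiskerLeft h R) P Q
    rw [hg] at ht
    -- The inner loop `V` has to be the last feedback factor, hence it is moved past the wire `E` of
    -- the context.
    refine .trans (.conj ((α_ U V E) ≪≫ whiskerLeftIso U (β_ V E) ≪≫ (α_ U E V).symm) ?_)
      (.tr _ _ ht)
    let L := [X', E, U, X, R, Y, U, Y', E, V, V]
    have := IsDiagram.of L (0⬝1) (3⬝4) a
    have := IsDiagram.of L (5⬝4) (7⬝8) b
    have := IsDiagram.of L ((3⬝2)⬝9) ((5⬝6)⬝10) f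
    exact diagram_eq L (0⬝(2⬝9)⬝1) (7⬝(6⬝8)⬝10)

end PartialTrace
end Feedback

/-! ### Composition of paths in the partial Int-construction -/

section Paths

open Wiring PartialTrace

local infixr:70 "⬝" => Wiring.Word.node

variable {C : Type u} [Category.{v} C] [MonoidalCategory C] [SymmetricCategory C]

/-- Exchange of the last two of three factors. -/
def swapBack (A B D : C) : (A ⊗ B) ⊗ D ⟶ (A ⊗ D) ⊗ B :=
  (α_ A B D).hom ≫ (A ◁ (β_ B D).hom) ≫ (α_ A D B).inv

namespace IntObj

/-- The morphism whose trace is the composition of the path. -/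
def loop {A B : IntObj C} (p : Quiver.Path A B) :
    (A.pos ⊗ B.neg) ⊗ vec p ⟶ (B.pos ⊗ A.neg) ⊗ vec p :=
  (α_ A.pos B.neg (vec p)).hom ≫ (A.pos ◁ (β_ B.neg (vec p)).hom) ≫ precomp p ≫
    (α_ B.pos A.neg (vec p)).inv

/-- Postcomposition of a morphism with feedback with an arrow. -/
def step {A B D : IntObj C} {U V : C} (e : B ⟶ D)
    (m : (A.pos ⊗ B.neg) ⊗ U ⟶ (B.pos ⊗ A.neg) ⊗ V) :
    (A.pos ⊗ D.neg) ⊗ (U ⊗ B.neg) ⟶ (D.pos ⊗ A.neg) ⊗ (V ⊗ B.neg) :=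
  ctx (swapBack A.pos D.neg B.neg)
    (swapBack B.pos A.neg D.neg ≫ (mor e ▷ A.neg) ≫ swapBack D.pos B.neg A.neg) m

theorem loop_nil (A : IntObj C) : loop (.nil : Quiver.Path A A) = 𝟙 _ := by
  exact diagram_eq [A.pos, A.neg] ((0⬝1)⬝.unit) ((0⬝1)⬝.unit)

/-- Writing the recursion as a context makes appending an arrow compatible with `LoopEq`. -/
theorem loop_cons {A B D : IntObj C} (p : Quiver.Path A B) (e : B ⟶ D) :
    loop (p.cons e) = step e (loop p) := by
  let L := [A.pos, vec p, B.neg, B.pos, A.neg, vec p, D.neg, D.pos, B.neg]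
  have := IsDiagram.of L (0⬝1⬝2) (3⬝4⬝5) (precomp p)
  have := IsDiagram.of L (3⬝6) (7⬝8) (mor e)
  exact diagram_eq L ((0⬝6)⬝1⬝2) ((7⬝4)⬝5⬝8)

/-- Composition of two morphisms with feedback. -/
def star {A B D : IntObj C} {U W W' : C} (m : (A.pos ⊗ B.neg) ⊗ U ⟶ (B.pos ⊗ A.neg) ⊗ U)
    (n : (B.pos ⊗ D.neg) ⊗ W ⟶ (D.pos ⊗ B.neg) ⊗ W') :
    (A.pos ⊗ D.neg) ⊗ (W ⊗ (U ⊗ B.neg)) ⟶ (D.pos ⊗ A.neg) ⊗ (W' ⊗ (U ⊗ B.neg)) :=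
  ctx (E := U ⊗ B.neg) (R := A.neg ⊗ U)
    (swapBack _ _ _ ≫ ((A.pos ◁ (β_ U B.neg).hom) ▷ _) ≫ ((α_ _ _ _).inv ▷ _) ≫ (m ▷ D.neg) ≫
      ((α_ _ _ _).hom ▷ _) ≫ swapBack _ _ _)
    (swapBack _ _ _ ≫ ((α_ _ _ _).inv ▷ _) ≫ (α_ _ _ _).hom) n

/-- A single arrow is a loop with unit feedback. This puts postcomposition into the form `star`,
where that arrow can be replaced by a whole loop. -/
theorem loopEq_step_star (T : PartialTrace C) {A B D : IntObj C} {U : C}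
    (m : (A.pos ⊗ B.neg) ⊗ U ⟶ (B.pos ⊗ A.neg) ⊗ U) (h : B ⟶ D) :
    T.LoopEq (step h m) (star m (hat (mor h))) := by
  refine .conj (λ_ _).symm ?_
  let L := [A.pos, B.neg, U, B.pos, A.neg, U, D.neg, D.pos, B.neg]
  have := IsDiagram.of L ((0⬝1)⬝2) ((3⬝4)⬝5) m
  have := IsDiagram.of L (3⬝6) (7⬝8) (mor h)
  exact diagram_eq L ((0⬝6)⬝2⬝1) ((7⬝4)⬝.unit⬝5⬝8)

/-- The two sides differ only in the order of their feedback wires; this is the induction step for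
concatenation. -/
theorem loopEq_star_step (T : PartialTrace C) {A B D E : IntObj C} {U W : C}
    (m : (A.pos ⊗ B.neg) ⊗ U ⟶ (B.pos ⊗ A.neg) ⊗ U)
    (n : (B.pos ⊗ D.neg) ⊗ W ⟶ (D.pos ⊗ B.neg) ⊗ W) (e : D ⟶ E) :
    T.LoopEq (star m (step e n)) (step e (star m n)) := by
  refine .conj (α_ _ _ _ ≪≫ whiskerLeftIso _ (β_ _ _) ≪≫ (α_ _ _ _).symm) ?_
  let L := [A.pos, B.neg, U, B.pos, A.neg, U, D.neg, W, D.pos, B.neg, W, E.neg, E.pos, D.neg]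
  have := IsDiagram.of L ((0⬝1)⬝2) ((3⬝4)⬝5) m
  have := IsDiagram.of L ((3⬝6)⬝7) ((8⬝9)⬝10) n
  have := IsDiagram.of L (8⬝11) (12⬝13) (mor e)
  exact diagram_eq L ((0⬝11)⬝(7⬝6)⬝2⬝1) ((12⬝4)⬝(10⬝5⬝9)⬝13)

/-- With the identity as second factor, the connecting wire `B.neg` returns directly to the input of
`m` and can be yanked. -/
theorem loopEq_star_id (T : PartialTrace C) {A B : IntObj C} {U : C}
    (m : (A.pos ⊗ B.neg) ⊗ U ⟶ (B.pos ⊗ A.neg) ⊗ U) :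
    T.LoopEq (star m (𝟙 ((B.pos ⊗ B.neg) ⊗ 𝟙_ C))) m := by
  have h := T.tr_yank (swapBack A.pos B.neg U) (swapBack A.pos U B.neg ≫ m)
  have h' : swapBack A.pos B.neg U ≫ swapBack A.pos U B.neg ≫ m = m := by
    let L := [A.pos, B.neg, U, B.pos, A.neg, U]
    have := IsDiagram.of L ((0⬝1)⬝2) ((3⬝4)⬝5) m
    exact diagram_eq L ((0⬝1)⬝2) ((3⬝4)⬝5)
  rw [h'] at h
  refine .trans (.conj (λ_ _) ?_) (.tr _ _ h)
  let L := [A.pos, B.neg, U, B.pos, A.neg, U, B.neg]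
  have := IsDiagram.of L ((0⬝1)⬝2) ((3⬝4)⬝5) m
  exact diagram_eq L ((0⬝6)⬝.unit⬝2⬝1) ((3⬝4)⬝5⬝6)

theorem loopEq_step {T : PartialTrace C} {A B D : IntObj C} {U V : C}
    {m : (A.pos ⊗ B.neg) ⊗ U ⟶ (B.pos ⊗ A.neg) ⊗ U} {n : (A.pos ⊗ B.neg) ⊗ V ⟶ (B.pos ⊗ A.neg) ⊗ V}
    (h : T.LoopEq m n) (e : B ⟶ D) : T.LoopEq (step e m) (step e n) :=
  h.ctx _ _

/-- No trace of `loop p` or `loop q` has to be defined: the relation compares the open loops. -/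
theorem loopEq_star_loop (T : PartialTrace C) {A B D : IntObj C} (p : Quiver.Path A B)
    (q : Quiver.Path B D) : T.LoopEq (star (loop p) (loop q)) (loop (p.comp q)) := by
  induction q with
  | nil =>
    rw [loop_nil]
    exact loopEq_star_id T (loop p)
  | cons q e ih =>
    rw [Quiver.Path.comp_cons, loop_cons, loop_cons]
    exact (loopEq_star_step T (loop p) (loop q) e).trans (loopEq_step ih e)

theorem loopEq_comp_loop {T : PartialTrace C} {A B D : IntObj C} {p q : Quiver.Path A B}
    (h : T.LoopEq (loop p) (loop q)) (s : Quiver.Path B D) :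
    T.LoopEq (loop (p.comp s)) (loop (q.comp s)) := by
  induction s with
  | nil => exact h
  | cons s e ih =>
    rw [Quiver.Path.comp_cons, Quiver.Path.comp_cons, loop_cons, loop_cons]
    exact loopEq_step ih e

theorem pathComp_nil (T : PartialTrace C) (A : IntObj C) :
    pathComp T (.nil : Quiver.Path A A) = Part.some (𝟙 (A.pos ⊗ A.neg)) := by
  change T.tr (𝟙_ C) (loop (.nil : Quiver.Path A A)) = _
  rw [loop_nil, ← T.tr_hat (𝟙 (A.pos ⊗ A.neg))]
  congr 1
  exact (id_whiskerRight _ _).symm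

theorem loopEq_loop_toPath (T : PartialTrace C) {A B : IntObj C} (f : A ⟶ B) :
    T.LoopEq (loop f.toPath) (hat (mor f)) := by
  change T.LoopEq (loop (Quiver.Path.nil.cons f)) (hat (mor f))
  rw [loop_cons, loop_nil]
  refine .trans (.conj (λ_ _) ?_) (loopEq_hat
    (by simpa using T.tr_yank (mor f) (𝟙 _)))
  let L := [A.pos, B.neg, B.pos, A.neg, A.neg]
  have := IsDiagram.of L (0⬝1) (2⬝3) (mor f)
  exact diagram_eq L ((0⬝1)⬝.unit⬝4) ((2⬝4)⬝3)

theorem pathComp_toPath (T : PartialTrace C) {A B : IntObj C} (f : A ⟶ B) :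
    pathComp T f.toPath = Part.some f :=
  (loopEq_loop_toPath T f).tr_eq_some

/-- `star` is a context of its second argument, so the arrow `h` may be replaced there by the loop
of `f`, whose trace it is. The prefix `r` may have undefined composition, and `s` is appended
afterwards. -/
theorem pathComp_comp (T : PartialTrace C) {A B D E : IntObj C} (r : Quiver.Path A B)
    (f : Quiver.Path B D) (s : Quiver.Path D E) {h : B ⟶ D} (hf : pathComp T f = Part.some h) :
    pathComp T ((r.comp h.toPath).comp s) = pathComp T ((r.comp f).comp s) := by
  refine (loopEq_comp_loop ?_ s).tr_eq
  change T.LoopEq (loop (r.cons h)) _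
  rw [loop_cons]
  refine (loopEq_step_star T (loop r) h).trans (.trans ?_ (loopEq_star_loop T r f))
  exact .ctx _ _ (.symm (loopEq_hat hf))

end IntObj

theorem intPara_isParacategory (T : PartialTrace C) : (intPara T).IsParacategory where
  comp_nil_dom A := by
    change (IntObj.pathComp T _).Dom
    rw [IntObj.pathComp_nil]
    trivial
  comp_toPath f := IntObj.pathComp_toPath T f
  comp_comp r f s h := IntObj.pathComp_comp T r f s (Part.some_get h).symm

end Paths

/-! ### Functoriality of the tensor product -/

section TensorFunctor

open Wiring PartialTrace

local infixr:70 "⬝" => Wiring.Word.node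

variable {C : Type u} [Category.{v} C] [MonoidalCategory C] [SymmetricCategory C]

/-- The input side of the tensor product of arrows. -/
def gather (A B E D : C) : (A ⊗ B) ⊗ (E ⊗ D) ⟶ (A ⊗ D) ⊗ (B ⊗ E) :=
  (α_ A B (E ⊗ D)).hom ≫ (A ◁ (α_ B E D).inv) ≫ (A ◁ (β_ (B ⊗ E) D).hom) ≫ (α_ A D (B ⊗ E)).inv

/-- The output side of the tensor product of arrows. -/
def scatter (D A E B : C) : (D ⊗ A) ⊗ (E ⊗ B) ⟶ (D ⊗ E) ⊗ (B ⊗ A) :=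
  (α_ D A (E ⊗ B)).hom ≫ (D ◁ (β_ A (E ⊗ B)).hom) ≫ (D ◁ (α_ E B A).hom) ≫ (α_ D E (B ⊗ A)).inv

/-- The middle-four interchange as an isomorphism. -/
def interchange (A B D E : C) : (A ⊗ B) ⊗ (D ⊗ E) ≅ (A ⊗ D) ⊗ (B ⊗ E) where
  hom := tensorμ A B D E
  inv := tensorδ A B D E

namespace IntObj

variable {A B D E : IntObj C}

/-- The tensor product of morphisms with feedback, as a context of the first factor. -/
def boxLeft {U W : C} (m : (A.pos ⊗ D.neg) ⊗ U ⟶ (D.pos ⊗ A.neg) ⊗ U)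
    (n : (B.pos ⊗ E.neg) ⊗ W ⟶ (E.pos ⊗ B.neg) ⊗ W) :
    ((A.pos ⊗ B.pos) ⊗ (E.neg ⊗ D.neg)) ⊗ (U ⊗ W) ⟶
      ((D.pos ⊗ E.pos) ⊗ (B.neg ⊗ A.neg)) ⊗ (U ⊗ W) :=
  ctx ((gather _ _ _ _ ▷ W) ≫ (α_ _ _ _).hom)
    ((_ ◁ n) ≫ (α_ _ _ _).inv ≫ (scatter _ _ _ _ ▷ W)) m

/-- The tensor product of morphisms with feedback, as a context of the second factor. -/
def boxRight {U W : C} (m : (A.pos ⊗ D.neg) ⊗ U ⟶ (D.pos ⊗ A.neg) ⊗ U)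
    (n : (B.pos ⊗ E.neg) ⊗ W ⟶ (E.pos ⊗ B.neg) ⊗ W) :
    ((A.pos ⊗ B.pos) ⊗ (E.neg ⊗ D.neg)) ⊗ (W ⊗ U) ⟶
      ((D.pos ⊗ E.pos) ⊗ (B.neg ⊗ A.neg)) ⊗ (W ⊗ U) :=
  ctx ((gather _ _ _ _ ▷ U) ≫ ((β_ _ _).hom ▷ U) ≫ (α_ _ _ _).hom)
    ((_ ◁ m) ≫ (α_ _ _ _).inv ≫ ((β_ _ _).hom ▷ U) ≫ (scatter _ _ _ _ ▷ U)) n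

/-- A context exposes one factor only. Passing between the two presentations allows both factors to
be evaluated, one after the other. -/
theorem loopEq_boxLeft_boxRight (T : PartialTrace C) {U W : C}
    (m : (A.pos ⊗ D.neg) ⊗ U ⟶ (D.pos ⊗ A.neg) ⊗ U)
    (n : (B.pos ⊗ E.neg) ⊗ W ⟶ (E.pos ⊗ B.neg) ⊗ W) :
    T.LoopEq (boxLeft m n) (boxRight m n) := by
  refine .conj (β_ _ _) ?_
  let L := [A.pos, D.neg, U, D.pos, A.neg, U, B.pos, E.neg, W, E.pos, B.neg, W]
  have := IsDiagram.of L ((0⬝1)⬝2) ((3⬝4)⬝5) m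
  have := IsDiagram.of L ((6⬝7)⬝8) ((9⬝10)⬝11) n
  exact diagram_eq L (((0⬝6)⬝7⬝1)⬝2⬝8) (((3⬝9)⬝10⬝4)⬝11⬝5)

theorem loopEq_boxRight_hat (T : PartialTrace C) (f : A ⟶ D) (g : B ⟶ E) :
    T.LoopEq (boxRight (hat (mor f)) (hat (mor g))) (hat (mor (tensHom f g))) := by
  refine .conj (λ_ _) ?_
  let L := [A.pos, D.neg, D.pos, A.neg, B.pos, E.neg, E.pos, B.neg]
  have := IsDiagram.of L (0⬝1) (2⬝3) (mor f)
  have := IsDiagram.of L (4⬝5) (6⬝7) (mor g)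
  exact diagram_eq L (((0⬝4)⬝5⬝1)⬝.unit⬝.unit) (((2⬝6)⬝7⬝3)⬝.unit)

/-- Both diagrams contain the same four boxes; the isomorphism sorts the feedback wires into those
of the first and those of the second factor. -/
theorem loopEq_step_boxLeft (T : PartialTrace C) {D' E' : IntObj C} {U W : C}
    (m : (A.pos ⊗ D.neg) ⊗ U ⟶ (D.pos ⊗ A.neg) ⊗ U)
    (n : (B.pos ⊗ E.neg) ⊗ W ⟶ (E.pos ⊗ B.neg) ⊗ W) (f : D ⟶ D') (g : E ⟶ E') :
    T.LoopEq (step (A := tens A B) (B := tens D E) (tensHom f g) (boxLeft m n))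
      (boxLeft (step f m) (step g n)) := by
  refine .conj (whiskerLeftIso (U ⊗ W) (β_ E.neg D.neg) ≪≫ interchange U W D.neg E.neg) ?_
  let L := [A.pos, D.neg, U, D.pos, A.neg, U, B.pos, E.neg, W, E.pos, B.neg, W,
    D'.neg, D'.pos, D.neg, E'.neg, E'.pos, E.neg]
  have := IsDiagram.of L ((0⬝1)⬝2) ((3⬝4)⬝5) m
  have := IsDiagram.of L ((6⬝7)⬝8) ((9⬝10)⬝11) n
  have := IsDiagram.of L (3⬝12) (13⬝14) (mor f)
  have := IsDiagram.of L (9⬝15) (16⬝17) (mor g)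
  exact diagram_eq L (((0⬝6)⬝15⬝12)⬝(2⬝8)⬝7⬝1) (((13⬝16)⬝10⬝4)⬝(5⬝14)⬝11⬝17)

theorem loopEq_id_boxLeft (T : PartialTrace C) (A B : IntObj C) :
    T.LoopEq (𝟙 (((A.pos ⊗ B.pos) ⊗ (B.neg ⊗ A.neg)) ⊗ 𝟙_ C))
      (boxLeft (𝟙 ((A.pos ⊗ A.neg) ⊗ 𝟙_ C)) (𝟙 ((B.pos ⊗ B.neg) ⊗ 𝟙_ C))) := by
  refine .conj (λ_ (𝟙_ C)).symm ?_
  exact diagram_eq [A.pos, A.neg, B.pos, B.neg] (((0⬝2)⬝3⬝1)⬝.unit) (((0⬝2)⬝3⬝1)⬝.unit⬝.unit)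

/-- The first components of a path in the product graph. -/
def fstPath (T : PartialTrace C) {X Y : ((intPara T).prod (intPara T)).Obj}
    (p : Quiver.Path X Y) : Quiver.Path X.1 Y.1 :=
  letI := ParaData.prodQuiver (intPara T) (intPara T)
  (ParaData.fst (intPara T) (intPara T)).mapPath p

/-- The second components of a path in the product graph. -/
def sndPath (T : PartialTrace C) {X Y : ((intPara T).prod (intPara T)).Obj}
    (p : Quiver.Path X Y) : Quiver.Path X.2 Y.2 :=
  letI := ParaData.prodQuiver (intPara T) (intPara T)
  (ParaData.snd (intPara T) (intPara T)).mapPath p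

/-- The tensor product of the arrows of a path in the product graph. -/
def tensorPath (T : PartialTrace C) {X Y : ((intPara T).prod (intPara T)).Obj}
    (p : Quiver.Path X Y) : Quiver.Path (tens X.1 X.2) (tens Y.1 Y.2) :=
  (intSymMon T).tensor.mapPath p

theorem loopEq_loop_tensorPath (T : PartialTrace C) {X Y : ((intPara T).prod (intPara T)).Obj}
    (p : Quiver.Path X Y) :
    T.LoopEq (loop (tensorPath T p)) (boxLeft (loop (fstPath T p)) (loop (sndPath T p))) := by
  induction p with
  | nil =>
    have h := loopEq_id_boxLeft T X.1 X.2
    have h₁ : loop (fstPath T (.nil : Quiver.Path X X)) = 𝟙 _ := loop_nil X.1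
    have h₂ : loop (sndPath T (.nil : Quiver.Path X X)) = 𝟙 _ := loop_nil X.2
    have h₃ : loop (tensorPath T (.nil : Quiver.Path X X)) = 𝟙 _ := loop_nil (tens X.1 X.2)
    rw [h₁, h₂, h₃]
    exact h
  | cons p e ih =>
    have h := (loopEq_step ih (tensHom e.1 e.2)).trans (loopEq_step_boxLeft T _ _ e.1 e.2)
    rw [← loop_cons, ← loop_cons, ← loop_cons] at h
    exact h

end IntObj

open IntObj in
theorem intSymMon_tensor_isFunctor (T : PartialTrace C) :
    ParaData.IsFunctor (P := (intPara T).prod (intPara T)) (Q := intPara T)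
      (intSymMon T).tensor := by
  intro X Y p h hh
  change h ∈ Part.map _ ((pathComp T (fstPath T p)).bind fun f =>
    (pathComp T (sndPath T p)).map fun g => (f, g)) at hh
  change h ∈ pathComp T (tensorPath T p)
  obtain ⟨_, hfg, rfl⟩ := (Part.mem_map_iff _).1 hh
  obtain ⟨f, hf, hfg⟩ := Part.mem_bind_iff.1 hfg
  obtain ⟨g, hg, rfl⟩ := (Part.mem_map_iff _).1 hfg
  rw [← Part.eq_some_iff] at hf hg ⊢
  refine LoopEq.tr_eq_some ((loopEq_loop_tensorPath T p).trans ?_)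
  -- The first loop is replaced by its value `f`, the roles of the factors are exchanged, and the
  -- second loop is replaced by `g`.
  refine .trans ((loopEq_hat hf).ctx _ _) ((loopEq_boxLeft_boxRight T _ _).trans
    (.trans ((loopEq_hat hg).ctx _ _) (loopEq_boxRight_hat T f g)))

end TensorFunctor

/-! ### Compositions that are always defined -/

section TotalCompositions

open Wiring PartialTrace

local infixr:70 "⬝" => Wiring.Word.node

variable {C : Type u} [Category.{v} C] [MonoidalCategory C] [SymmetricCategory C]

namespace PartialTrace

/-- Two wires around the loop: from `a` to `f`, and from `f` to `b`. -/
def yankTwo {X Y Z W P Q : C} (a : X ⟶ Y ⊗ P) (f : Y ⊗ P ⟶ Z ⊗ Q) (b : Z ⊗ Q ⟶ W) :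
    X ⊗ (P ⊗ Q) ⟶ W ⊗ (P ⊗ Q) :=
  (α_ X P Q).inv ≫
    yank ((a ▷ P) ≫ swapBack Y P P ≫ (f ▷ P) ≫ swapBack Z Q P) (swapBack Z P Q ≫ (b ▷ P)) ≫
    (α_ W P Q).hom

/-- The wire `Q` is yanked first. What is left is a yank along `P`, so the double trace is defined.
-/
theorem tr_yankTwo (T : PartialTrace C) {X Y Z W P Q : C} (a : X ⟶ Y ⊗ P) (f : Y ⊗ P ⟶ Z ⊗ Q)
    (b : Z ⊗ Q ⟶ W) : T.tr (P ⊗ Q) (yankTwo a f b) = Part.some (a ≫ f ≫ b) := by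
  have h : ((a ▷ P) ≫ swapBack Y P P ≫ (f ▷ P) ≫ swapBack Z Q P) ≫ swapBack Z P Q ≫ (b ▷ P) =
      yank a (f ≫ b) := by
    let L := [X, Y, P, Z, Q, W, P]
    have := IsDiagram.of L 0 (1⬝2) a
    have := IsDiagram.of L (1⬝6) (3⬝4) f
    have := IsDiagram.of L (3⬝4) 5 b
    exact diagram_eq L (0⬝6) (5⬝2)
  have h' := T.tr_yank ((a ▷ P) ≫ swapBack Y P P ≫ (f ▷ P) ≫ swapBack Z Q P)
    (swapBack Z P Q ≫ (b ▷ P))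
  rw [h] at h'
  exact (LoopEq.tr _ _ h').tr_eq.trans (T.tr_yank _ _)

end PartialTrace

namespace IntObj

/-- The morphism whose trace is the composition of two arrows. -/
def seq {A B D : IntObj C} (f : A ⟶ B) (g : B ⟶ D) :
    (A.pos ⊗ D.neg) ⊗ B.neg ⟶ (D.pos ⊗ A.neg) ⊗ B.neg :=
  swapBack _ _ _ ≫ (mor f ▷ D.neg) ≫ swapBack _ _ _ ≫ (mor g ▷ A.neg) ≫ swapBack _ _ _

/-- The official loop of a two-arrow path also feeds back the negative wire of the source; that part
is already evaluated here, leaving the single wire `B.neg`. -/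
theorem pathComp_two (T : PartialTrace C) {A B D : IntObj C} (f : A ⟶ B) (g : B ⟶ D) :
    pathComp T (f.toPath.cons g) = T.tr B.neg (seq f g) := by
  refine LoopEq.tr_eq (f := loop (f.toPath.cons g)) ?_
  rw [loop_cons]
  refine (loopEq_step (loopEq_loop_toPath T f) g).trans (.conj (λ_ _) ?_)
  let L := [A.pos, B.neg, B.pos, A.neg, D.neg, D.pos, B.neg]
  have := IsDiagram.of L (0⬝1) (2⬝3) (mor f)
  have := IsDiagram.of L (2⬝4) (5⬝6) (mor g)
  exact diagram_eq L ((0⬝4)⬝.unit⬝1) ((5⬝3)⬝6)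

/-- An arrow consisting of a morphism on positive parts and a morphism on negative parts. -/
def split {A B : IntObj C} (h : A.pos ⟶ B.pos) (k : B.neg ⟶ A.neg) : A ⟶ B := ofMor (h ⊗ₘ k)

/-- The negative wire of the middle object runs from `g` to `k`, and `k` does not feed `h`; there is
no cycle and one yank suffices. -/
theorem pathComp_split_left (T : PartialTrace C) {A B D : IntObj C} (h : A.pos ⟶ B.pos)
    (k : B.neg ⟶ A.neg) (g : B ⟶ D) :
    pathComp T ((split h k).toPath.cons g) =
      Part.some (ofMor ((h ▷ D.neg) ≫ mor g ≫ (D.pos ◁ k))) := by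
  have := T.tr_yank ((h ▷ D.neg) ≫ mor g) (D.pos ◁ k)
  rw [Category.assoc] at this
  rw [pathComp_two, ← this]
  congr 1
  let L := [A.pos, B.pos, B.neg, A.neg, D.neg, D.pos, B.neg]
  have := IsDiagram.of L 0 1 h
  have := IsDiagram.of L 2 3 k
  have := IsDiagram.of L (1⬝4) (5⬝6) (mor g)
  exact diagram_eq L ((0⬝4)⬝2) ((5⬝3)⬝6)

theorem pathComp_split_right (T : PartialTrace C) {A B D : IntObj C} (f : A ⟶ B)
    (h : B.pos ⟶ D.pos) (k : D.neg ⟶ B.neg) :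
    pathComp T (f.toPath.cons (split h k)) =
      Part.some (ofMor ((A.pos ◁ k) ≫ mor f ≫ (h ▷ A.neg))) := by
  rw [pathComp_two, ← T.tr_yank (A.pos ◁ k) (mor f ≫ (h ▷ A.neg))]
  congr 1
  let L := [A.pos, B.neg, B.pos, A.neg, D.neg, D.pos, B.neg]
  have := IsDiagram.of L (0⬝1) (2⬝3) (mor f)
  have := IsDiagram.of L 2 5 h
  have := IsDiagram.of L 4 6 k
  exact diagram_eq L ((0⬝4)⬝1) ((5⬝3)⬝6)

/-- Rebracketing of the source of an arrow. -/
def assocSource {P Q R B : IntObj C} (f : tens (tens P Q) R ⟶ B) : tens P (tens Q R) ⟶ B :=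
  ofMor (A := tens P (tens Q R)) (((α_ P.pos Q.pos R.pos).inv ▷ B.neg) ≫ mor f ≫
    (B.pos ◁ (α_ R.neg Q.neg P.neg).inv))

/-- Rebracketing of the target of an arrow. -/
def assocTarget {A P Q R : IntObj C} (f : A ⟶ tens (tens P Q) R) : A ⟶ tens P (tens Q R) :=
  ofMor (B := tens P (tens Q R)) ((A.pos ◁ (α_ R.neg Q.neg P.neg).hom) ≫ mor f ≫
    ((α_ P.pos Q.pos R.pos).hom ▷ A.neg))

/-- The identity arrow. -/
def idHom (A : IntObj C) : A ⟶ A := ofMor (𝟙 (A.pos ⊗ A.neg))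

/-- For units and counits the feedback splits into wires entering `φ` and wires leaving it. Nothing
returns from an output of `φ` to its input, so the trace exists. -/
theorem pathComp_of_yankTwo (T : PartialTrace C) {A B D : IntObj C} {f : A ⟶ B} {g : B ⟶ D}
    {Y Z P Q : C} (e : B.neg ≅ P ⊗ Q) (a : A.pos ⊗ D.neg ⟶ Y ⊗ P) (φ : Y ⊗ P ⟶ Z ⊗ Q)
    (b : Z ⊗ Q ⟶ D.pos ⊗ A.neg) (h : seq f g ≫ (_ ◁ e.hom) = (_ ◁ e.hom) ≫ yankTwo a φ b) :
    pathComp T (f.toPath.cons g) = Part.some (ofMor (a ≫ φ ≫ b)) := by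
  rw [pathComp_two, ← T.tr_yankTwo]
  exact (LoopEq.conj e h).tr_eq

theorem pathComp_unit_right (T : PartialTrace C) {A B D : IntObj C} (f : tens A (dual D) ⟶ B) :
    pathComp T ((tensHom (idHom A) (unitHom D)).toPath.cons (assocSource (tensHom f (idHom D)))) =
      Part.some (ofMor (A := tens A one) (B := tens B D)
        ((((ρ_ A.pos).hom ▷ _) ≫ (α_ _ _ _).inv ≫ swapBack A.pos D.neg B.neg) ≫
          (swapBack A.pos B.neg D.neg ≫ mor f) ≫
          (α_ B.pos D.pos A.neg).inv ≫ (_ ◁ (λ_ A.neg).inv))) := by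
  refine pathComp_of_yankTwo T (α_ D.neg D.pos A.neg) _ _ _ ?_
  let L := [A.pos, D.neg, B.neg, B.pos, D.pos, A.neg, D.neg, D.pos, A.neg]
  have := IsDiagram.of L ((0⬝6)⬝2) (3⬝4⬝5) (mor f)
  exact diagram_eq L (((0⬝.unit)⬝1⬝2)⬝(6⬝7)⬝8) (((3⬝7)⬝.unit⬝8)⬝1⬝4⬝5)

theorem pathComp_counit_right (T : PartialTrace C) {A B D : IntObj C} (g : A ⟶ tens B D) :
    pathComp T ((assocTarget (tensHom g (idHom (dual D)))).toPath.cons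
        (tensHom (idHom B) (counitHom D))) =
      Part.some (ofMor (A := tens A (dual D)) (B := tens B one)
        (((α_ A.pos D.neg _).hom ≫ (A.pos ◁ (D.neg ◁ (λ_ B.neg).hom))) ≫
          (mor g ≫ swapBack B.pos D.pos A.neg) ≫
          swapBack B.pos A.neg D.pos ≫ (α_ B.pos D.pos A.neg).hom ≫ ((ρ_ B.pos).inv ▷ _))) := by
  refine pathComp_of_yankTwo T (α_ D.pos D.neg B.neg ≪≫ β_ D.pos (D.neg ⊗ B.neg)) _ _ _ ?_
  let L := [A.pos, D.neg, B.neg, B.pos, D.pos, A.neg, D.pos, D.neg, B.neg]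
  have := IsDiagram.of L (0⬝7⬝8) ((3⬝4)⬝5) (mor g)
  exact diagram_eq L (((0⬝1)⬝.unit⬝2)⬝(6⬝7)⬝8) (((3⬝.unit)⬝6⬝5)⬝(1⬝2)⬝4)

theorem pathComp_unit_left (T : PartialTrace C) {A B D : IntObj C} (h : tens A B ⟶ D) :
    pathComp T ((assocTarget (tensHom (unitHom A) (idHom B))).toPath.cons
        (tensHom (idHom (dual A)) h)) =
      Part.some (ofMor (A := tens one B) (B := tens (dual A) D)
        ((((λ_ B.pos).hom ▷ _) ≫ (α_ B.pos D.neg A.pos).inv) ≫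
          ((β_ (B.pos ⊗ D.neg) A.pos).hom ≫ (α_ _ _ _).inv ≫ mor h) ≫
          (α_ D.pos B.neg A.neg).inv ≫ (β_ _ _).hom ≫ (α_ _ _ _).inv ≫ (_ ◁ (ρ_ B.neg).inv))) := by
  refine pathComp_of_yankTwo T (β_ (B.neg ⊗ A.neg) A.pos) _ _ _ ?_
  let L := [A.pos, B.pos, D.neg, D.pos, B.neg, A.neg, B.neg, A.neg, A.pos]
  have := IsDiagram.of L ((8⬝1)⬝2) (3⬝4⬝5) (mor h)
  exact diagram_eq L (((.unit⬝1)⬝2⬝0)⬝(6⬝7)⬝8) (((7⬝3)⬝6⬝.unit)⬝0⬝4⬝5)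

theorem pathComp_counit_left (T : PartialTrace C) {A B D : IntObj C} (k : B ⟶ tens (dual A) D) :
    pathComp T ((tensHom (idHom A) k).toPath.cons
        (assocSource (tensHom (counitHom A) (idHom D)))) =
      Part.some (ofMor (A := tens A B) (B := tens one D)
        (((_ ◁ (ρ_ D.neg).hom) ≫ ((β_ A.pos B.pos).hom ▷ _) ≫ (α_ _ _ _).hom ≫
            (B.pos ◁ (β_ A.pos D.neg).hom)) ≫
          (mor k ≫ (α_ A.neg D.pos B.neg).hom ≫ (β_ A.neg (D.pos ⊗ B.neg)).hom) ≫
          (α_ _ _ _).hom ≫ ((λ_ D.pos).inv ▷ _))) := by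
  refine pathComp_of_yankTwo T (Iso.refl ((D.neg ⊗ A.pos) ⊗ A.neg)) _ _ _ ?_
  let L := [A.pos, B.pos, D.neg, A.neg, D.pos, B.neg, D.neg, A.pos, A.neg]
  have := IsDiagram.of L (1⬝6⬝7) ((3⬝4)⬝5) (mor k)
  exact diagram_eq L (((0⬝1)⬝2⬝.unit)⬝(6⬝7)⬝8) (((.unit⬝4)⬝5⬝8)⬝(2⬝0)⬝3)

/-- The symmetry acts separately on positive and negative parts, so the compositions with it fall
under the two `pathComp_split` lemmas. -/
theorem tensHom_idHom_symm (X A B : IntObj C) :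
    tensHom (idHom X) (symm A B) =
      split (A := tens X (tens A B)) (B := tens X (tens B A)) (X.pos ◁ (β_ A.pos B.pos).hom)
        ((β_ A.neg B.neg).hom ▷ X.neg) := by
  exact diagram_eq [X.pos, X.neg, A.pos, A.neg, B.pos, B.neg] ((0⬝2⬝4)⬝(3⬝5)⬝1) ((0⬝4⬝2)⬝(5⬝3)⬝1)

theorem symm_naturality_left (T : PartialTrace C) {A A' : IntObj C} (B : IntObj C) (f : A ⟶ A') :
    pathComp T ((tensHom f (idHom B)).toPath.cons (symm A' B)) =
      pathComp T ((symm A B).toPath.cons (tensHom (idHom B) f)) := by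
  refine (pathComp_split_right T _ _ _).trans (.trans ?_ (pathComp_split_left T _ _ _).symm)
  congr 1
  let L := [A.pos, A'.neg, A'.pos, A.neg, B.pos, B.neg]
  have := IsDiagram.of L (0⬝1) (2⬝3) (mor f)
  exact diagram_eq L ((0⬝4)⬝1⬝5) ((4⬝2)⬝5⬝3)

theorem symm_naturality_right (T : PartialTrace C) (A : IntObj C) {B B' : IntObj C} (g : B ⟶ B') :
    pathComp T ((tensHom (idHom A) g).toPath.cons (symm A B')) =
      pathComp T ((symm A B).toPath.cons (tensHom g (idHom A))) := by
  refine (pathComp_split_right T _ _ _).trans (.trans ?_ (pathComp_split_left T _ _ _).symm)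
  congr 1
  let L := [B.pos, B'.neg, B'.pos, B.neg, A.pos, A.neg]
  have := IsDiagram.of L (0⬝1) (2⬝3) (mor g)
  exact diagram_eq L ((4⬝0)⬝5⬝1) ((2⬝4)⬝3⬝5)

theorem symm_symm (T : PartialTrace C) (A B : IntObj C) :
    pathComp T ((symm A B).toPath.cons (symm B A)) = Part.some (idHom (tens A B)) := by
  refine (pathComp_split_left T _ _ _).trans ?_
  congr 1
  exact diagram_eq [A.pos, A.neg, B.pos, B.neg] ((0⬝2)⬝3⬝1) ((0⬝2)⬝3⬝1)

end IntObj
end TotalCompositions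

/-! ### The compact closed structure in the strict case -/

section Strict

open Wiring PartialTrace

local infixr:70 "⬝" => Wiring.Word.node

namespace IsStrictMonoidal

variable {C : Type u} [Category.{v} C] [MonoidalCategory C] [IsStrictMonoidal C]

/-- The equality proof is arbitrary, so that any transport of this shape can be exchanged for a
structural isomorphism, which `diagram_eq` understands. -/
theorem associator_hom_eq (X Y Z : C) (h : (X ⊗ Y) ⊗ Z = X ⊗ (Y ⊗ Z)) :
    (α_ X Y Z).hom = eqToHom h := by
  rw [associator_eq]; rfl

theorem associator_inv_eq (X Y Z : C) (h : X ⊗ (Y ⊗ Z) = (X ⊗ Y) ⊗ Z) :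
    (α_ X Y Z).inv = eqToHom h := by
  rw [associator_eq]; rfl

theorem leftUnitor_hom_eq (X : C) (h : 𝟙_ C ⊗ X = X) : (λ_ X).hom = eqToHom h := by
  rw [leftUnitor_eq]; rfl

theorem leftUnitor_inv_eq (X : C) (h : X = 𝟙_ C ⊗ X) : (λ_ X).inv = eqToHom h := by
  rw [leftUnitor_eq]; rfl

theorem rightUnitor_hom_eq (X : C) (h : X ⊗ 𝟙_ C = X) : (ρ_ X).hom = eqToHom h := by
  rw [rightUnitor_eq]; rfl

theorem rightUnitor_inv_eq (X : C) (h : X = X ⊗ 𝟙_ C) : (ρ_ X).inv = eqToHom h := by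
  rw [rightUnitor_eq]; rfl

end IsStrictMonoidal

open IsStrictMonoidal

theorem Quiver.Hom.cast_eq_eqToHom {C : Type u} [Category.{v} C] {A B A' B' : C} (hA : A = A')
    (hB : B = B') (f : A ⟶ B) : f.cast hA hB = eqToHom hA.symm ≫ f ≫ eqToHom hB := by
  subst hA hB
  simp

namespace IntObj

variable {C : Type u} [Category.{v} C] [MonoidalCategory C]

/-- Transport of an arrow along equalities of objects, in terms of the underlying morphism. -/
theorem cast_eq {A A' B B' : IntObj C} (hA : A = A') (hB : B = B') (f : A ⟶ B)
    (a : A'.pos ⟶ A.pos) (b : B'.neg ⟶ B.neg) (c : B.pos ⟶ B'.pos) (d : A.neg ⟶ A'.neg)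
    (ha : a = eqToHom (congrArg pos hA.symm)) (hb : b = eqToHom (congrArg neg hB.symm))
    (hc : c = eqToHom (congrArg pos hB)) (hd : d = eqToHom (congrArg neg hA)) :
    f.cast hA hB = ofMor ((a ⊗ₘ b) ≫ mor f ≫ (c ⊗ₘ d)) := by
  subst hA hB ha hb hc hd
  simp

theorem tens_assoc [IsStrictMonoidal C] (A B D : IntObj C) : tens (tens A B) D = tens A (tens B D) :=
  IntObj.ext (tensor_assoc _ _ _) (tensor_assoc _ _ _).symm

theorem tens_one [IsStrictMonoidal C] (A : IntObj C) : tens A one = A :=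
  IntObj.ext (tensor_unit _) (unit_tensor _)

theorem one_tens [IsStrictMonoidal C] (A : IntObj C) : tens one A = A :=
  IntObj.ext (unit_tensor _) (tensor_unit _)

variable [SymmetricCategory C]

/-- Only the outer objects are transported; the middle object, and with it the feedback wire, stays
fixed. -/
theorem pathComp_cast (T : PartialTrace C) {A A' B D D' : IntObj C} (hA : A = A') (hD : D = D')
    {f : A ⟶ B} {g : B ⟶ D} {h : A ⟶ D} (hh : pathComp T (f.toPath.cons g) = Part.some h) :
    pathComp T ((f.cast hA rfl).toPath.cons (g.cast rfl hD)) = Part.some (h.cast hA hD) := by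
  subst hA hD
  exact hh

variable [IsStrictMonoidal C]

theorem cast_assocSource {P Q R B : IntObj C} (f : tens (tens P Q) R ⟶ B) :
    f.cast (tens_assoc P Q R) rfl = assocSource f := by
  rw [cast_eq _ _ f (α_ _ _ _).inv (𝟙 _) (𝟙 _) (α_ _ _ _).inv (associator_inv_eq _ _ _ _) rfl rfl
    (associator_inv_eq _ _ _ _)]
  let L := [P.pos, Q.pos, R.pos, B.neg, B.pos, R.neg, Q.neg, P.neg]
  have := IsDiagram.of L (((0⬝1)⬝2)⬝3) (4⬝5⬝6⬝7) (mor f)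
  exact diagram_eq L ((0⬝1⬝2)⬝3) (4⬝(5⬝6)⬝7)

theorem cast_assocTarget {A P Q R : IntObj C} (f : A ⟶ tens (tens P Q) R) :
    f.cast rfl (tens_assoc P Q R) = assocTarget f := by
  rw [cast_eq _ _ f (𝟙 _) (α_ _ _ _).hom (α_ _ _ _).hom (𝟙 _) rfl (associator_hom_eq _ _ _ _)
    (associator_hom_eq _ _ _ _) rfl]
  let L := [P.pos, Q.pos, R.pos, A.neg, A.pos, R.neg, Q.neg, P.neg]
  have := IsDiagram.of L (4⬝5⬝6⬝7) (((0⬝1)⬝2)⬝3) (mor f)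
  exact diagram_eq L (4⬝(5⬝6)⬝7) ((0⬝1⬝2)⬝3)

theorem tensHom_assoc {A B D A' B' D' : IntObj C} (f : A ⟶ A') (g : B ⟶ B') (h : D ⟶ D') :
    (tensHom (tensHom f g) h).cast (tens_assoc A B D) (tens_assoc A' B' D') =
      tensHom f (tensHom g h) := by
  rw [cast_eq _ _ _ (α_ _ _ _).inv (α_ _ _ _).hom (α_ _ _ _).hom (α_ _ _ _).inv
    (associator_inv_eq _ _ _ _) (associator_hom_eq _ _ _ _) (associator_hom_eq _ _ _ _)
    (associator_inv_eq _ _ _ _)]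
  let L := [A.pos, A'.neg, A'.pos, A.neg, B.pos, B'.neg, B'.pos, B.neg, D.pos, D'.neg, D'.pos,
    D.neg]
  have := IsDiagram.of L (0⬝1) (2⬝3) (mor f)
  have := IsDiagram.of L (4⬝5) (6⬝7) (mor g)
  have := IsDiagram.of L (8⬝9) (10⬝11) (mor h)
  exact diagram_eq L ((0⬝4⬝8)⬝(9⬝5)⬝1) ((2⬝6⬝10)⬝(11⬝7)⬝3)

theorem tensHom_one {A B : IntObj C} (f : A ⟶ B) :
    (tensHom f (idHom one)).cast (tens_one A) (tens_one B) = f := by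
  rw [cast_eq _ _ _ (ρ_ _).inv (λ_ _).inv (ρ_ _).hom (λ_ _).hom
    (rightUnitor_inv_eq _ _) (leftUnitor_inv_eq _ _) (rightUnitor_hom_eq _ _)
    (leftUnitor_hom_eq _ _)]
  let L := [A.pos, B.neg, B.pos, A.neg]
  have := IsDiagram.of L (0⬝1) (2⬝3) (mor f)
  exact diagram_eq L (0⬝1) (2⬝3)

theorem one_tensHom {A B : IntObj C} (f : A ⟶ B) :
    (tensHom (idHom one) f).cast (one_tens A) (one_tens B) = f := by
  rw [cast_eq _ _ _ (λ_ _).inv (ρ_ _).inv (λ_ _).hom (ρ_ _).hom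
    (leftUnitor_inv_eq _ _) (rightUnitor_inv_eq _ _) (leftUnitor_hom_eq _ _)
    (rightUnitor_hom_eq _ _)]
  let L := [A.pos, B.neg, B.pos, A.neg]
  have := IsDiagram.of L (0⬝1) (2⬝3) (mor f)
  exact diagram_eq L (0⬝1) (2⬝3)

theorem symm_hexagon (T : PartialTrace C) (A B D : IntObj C) :
    pathComp T (((tensHom (symm A B) (idHom D)).cast (tens_assoc A B D)
      (tens_assoc B A D)).toPath.cons
      ((tensHom (idHom B) (symm A D)).cast rfl (tens_assoc B D A).symm)) =
    Part.some (symm A (tens B D)) := by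
  have h₁ : (tensHom (symm A B) (idHom D)).cast (tens_assoc A B D) (tens_assoc B A D) =
      split (A := tens A (tens B D)) (B := tens B (tens A D))
        ((α_ _ _ _).inv ≫ ((β_ A.pos B.pos).hom ▷ D.pos) ≫ (α_ _ _ _).hom)
        ((α_ _ _ _).hom ≫ (D.neg ◁ (β_ A.neg B.neg).hom) ≫ (α_ _ _ _).inv) := by
    rw [cast_eq _ _ _ (α_ _ _ _).inv (α_ _ _ _).hom (α_ _ _ _).hom (α_ _ _ _).inv
      (associator_inv_eq _ _ _ _) (associator_hom_eq _ _ _ _) (associator_hom_eq _ _ _ _)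
      (associator_inv_eq _ _ _ _)]
    exact diagram_eq [A.pos, A.neg, B.pos, B.neg, D.pos, D.neg] ((0⬝2⬝4)⬝(5⬝1)⬝3)
      ((2⬝0⬝4)⬝(5⬝3)⬝1)
  rw [h₁, pathComp_split_left, cast_eq _ _ (tensHom (idHom B) (symm A D)) (𝟙 _) (α_ _ _ _).inv
    (α_ _ _ _).inv (𝟙 _) rfl (associator_inv_eq _ _ _ _) (associator_inv_eq _ _ _ _) rfl]
  congr 1
  exact diagram_eq [A.pos, A.neg, B.pos, B.neg, D.pos, D.neg] ((0⬝2⬝4)⬝1⬝5⬝3)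
    (((2⬝4)⬝0)⬝(5⬝3)⬝1)

theorem snake (T : PartialTrace C) (A : IntObj C) :
    pathComp T (((tensHom (idHom A) (unitHom A)).cast (tens_one A) rfl).toPath.cons
      ((tensHom (counitHom A) (idHom A)).cast (tens_assoc A (dual A) A) (one_tens A))) =
    Part.some (idHom A) := by
  -- The snake is the unit composition with the counit as the arrow `f`; in the value computed there
  -- all boxes disappear.
  have h := pathComp_cast T (tens_one A) (one_tens A) (pathComp_unit_right T (counitHom A))
  rw [← cast_assocSource, Quiver.Hom.cast_cast] at h
  refine h.trans (congrArg Part.some ?_)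
  rw [cast_eq _ _ _ (ρ_ _).inv (ρ_ _).inv (λ_ _).hom (λ_ _).hom (rightUnitor_inv_eq _ _)
    (rightUnitor_inv_eq _ _) (leftUnitor_hom_eq _ _) (leftUnitor_hom_eq _ _)]
  exact diagram_eq [A.pos, A.neg] (0⬝1) (0⬝1)

theorem snake_dual (T : PartialTrace C) (A : IntObj C) :
    pathComp T (((tensHom (unitHom A) (idHom (dual A))).cast (one_tens (dual A))
      (tens_assoc (dual A) A (dual A))).toPath.cons
      ((tensHom (idHom (dual A)) (counitHom A)).cast rfl (tens_one (dual A)))) =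
    Part.some (idHom (dual A)) := by
  have h := pathComp_cast T (one_tens (dual A)) (tens_one (dual A))
    (pathComp_unit_left T (counitHom A))
  rw [← cast_assocTarget, Quiver.Hom.cast_cast] at h
  refine h.trans (congrArg Part.some ?_)
  rw [cast_eq _ _ _ (λ_ _).inv (λ_ _).inv (ρ_ _).hom (ρ_ _).hom (leftUnitor_inv_eq _ _)
    (leftUnitor_inv_eq _ _) (rightUnitor_hom_eq _ _) (rightUnitor_hom_eq _ _)]
  exact diagram_eq [A.pos, A.neg] (1⬝0) (1⬝0)

end IntObj

end Strict

/-! ### The embedding of the category and the final assembly -/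

section Main

open Wiring PartialTrace IsStrictMonoidal

local infixr:70 "⬝" => Wiring.Word.node

namespace IntObj

variable {C : Type u} [Category.{v} C] [MonoidalCategory C]

theorem nHom_injective {A B : C} {f g : A ⟶ B} (h : nHom f = nHom g) : f = g := by
  have h' : (ρ_ A).hom ≫ f ≫ (ρ_ B).inv = (ρ_ A).hom ≫ g ≫ (ρ_ B).inv := h
  simpa using h'

theorem nHom_surjective {A B : C} (g : A ⊗ 𝟙_ C ⟶ B ⊗ 𝟙_ C) : ∃ f : A ⟶ B, nHom f = g :=
  ⟨(ρ_ A).inv ≫ g ≫ (ρ_ B).hom, by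
    change (ρ_ A).hom ≫ ((ρ_ A).inv ≫ g ≫ (ρ_ B).hom) ≫ (ρ_ B).inv = g
    simp⟩

theorem tens_nObj [IsStrictMonoidal C] (A B : C) : tens (nObj A) (nObj B) = nObj (A ⊗ B) :=
  IntObj.ext rfl (unit_tensor (𝟙_ C))

end IntObj

variable {C : Type u} [Category.{v} C] [MonoidalCategory C] [SymmetricCategory C]

namespace IntObj

/-- The negative part is the identity of the unit object, so composites of arrows in the image of
the embedding are always defined. -/
theorem nHom_eq_split {A B : C} (f : A ⟶ B) :
    nHom f = split (A := nObj A) (B := nObj B) f (𝟙 (𝟙_ C)) := by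
  let L := [A, B]
  have := IsDiagram.of L 0 1 f
  exact diagram_eq L (0⬝.unit) (1⬝.unit)

theorem nHom_comp (T : PartialTrace C) {A B D : C} (f : A ⟶ B) (g : B ⟶ D) :
    pathComp T ((nHom f).toPath.cons (nHom g)) = Part.some (nHom (f ≫ g)) := by
  rw [nHom_eq_split f]
  refine (pathComp_split_left T (A := nObj A) (B := nObj B) f (𝟙 _) (nHom g)).trans
    (congrArg Part.some ?_)
  let L := [A, B, D]
  have := IsDiagram.of L 0 1 f
  have := IsDiagram.of L 1 2 g
  exact diagram_eq L (0⬝.unit) (2⬝.unit)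

end IntObj

open IntObj in
theorem intN_isFunctor (T : PartialTrace C) :
    ParaData.IsFunctor (P := paraOfCategory C) (Q := intPara T) (intN T) := by
  intro A B p
  -- Composition in a category is total, so the directed relation holds here as an equality, by
  -- induction on the path.
  refine le_of_eq ?_
  rw [Part.map_some]
  symm
  induction p with
  | nil =>
    refine (pathComp_nil T (nObj A)).trans (congrArg Part.some ?_)
    change 𝟙 (A ⊗ 𝟙_ C) = (ρ_ A).hom ≫ 𝟙 A ≫ (ρ_ A).inv
    simp
  | cons p e ih =>
    -- The mapped initial segment is contracted to the image of its composite, which leaves a path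
    -- of length two.
    have h := pathComp_comp T .nil ((intN T).mapPath p) ((nHom e).toPath) ih
    rw [Quiver.Path.nil_comp ((intN T).mapPath p)] at h
    exact h.symm.trans (nHom_comp T (composePath p) e)

open IntObj in
theorem intPara_one (T : PartialTrace C) (h : (intPara T).IsParacategory) (A : IntObj C) :
    h.one A = idHom A :=
  Part.get_eq_of_mem (Part.eq_some_iff.1 (pathComp_nil T A)) _

variable [IsStrictMonoidal C]

open IntObj in
/-- The partial Int-construction is a strict symmetric monoidal paracategory. -/
theorem intSymMon_isStrictSymmetricMonoidal (T : PartialTrace C) :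
    (intSymMon T).IsStrictSymmetricMonoidal where
  toIsParacategory := intPara_isParacategory T
  tensor_isFunctor := intSymMon_tensor_isFunctor T
  assoc_obj := tens_assoc
  assoc_hom := tensHom_assoc
  tensor_unit_obj := tens_one
  unit_tensor_obj := one_tens
  tensor_unit_hom f := by
    rw [intPara_one]
    exact tensHom_one f
  unit_tensor_hom f := by
    rw [intPara_one]
    exact one_tensHom f
  sym_total_left {X A B Y} f := by
    rw [intPara_one]
    change (pathComp T ((tensHom (idHom X) (symm A B)).toPath.cons f)).Dom
    rw [tensHom_idHom_symm]
    exact (congrArg Part.Dom (pathComp_split_left T _ _ f)).mpr trivial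
  sym_total_right {X A B Y} g := by
    rw [intPara_one]
    change (pathComp T (g.toPath.cons (tensHom (idHom X) (symm A B)))).Dom
    rw [tensHom_idHom_symm]
    exact (congrArg Part.Dom (pathComp_split_right T g _ _)).mpr trivial
  sym_natural_left B f := by
    rw [intPara_one]
    exact symm_naturality_left T B f
  sym_natural_right A _ _ g := by
    rw [intPara_one]
    exact symm_naturality_right T A g
  sym_sym A B := by
    rw [intPara_one]
    exact symm_symm T A B
  hexagon A B D := by
    rw [intPara_one, intPara_one]
    exact symm_hexagon T A B D

open IntObj in
/-- The partial Int-construction is a strict symmetric compact closed paracategory. -/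
theorem intP_isCompactClosed (T : PartialTrace C) : (intP T).IsCompactClosed where
  toIsStrictSymmetricMonoidal := intSymMon_isStrictSymmetricMonoidal T
  total_unit_right {A B D} f := by
    rw [intPara_one, intPara_one]
    change (pathComp T ((tensHom (idHom A) (unitHom D)).toPath.cons
      ((tensHom f (idHom D)).cast (tens_assoc A (dual D) D) rfl))).Dom
    rw [cast_assocSource, pathComp_unit_right]
    trivial
  total_counit_right {A B D} g := by
    rw [intPara_one, intPara_one]
    change (pathComp T (((tensHom g (idHom (dual D))).cast rfl
      (tens_assoc B D (dual D))).toPath.cons (tensHom (idHom B) (counitHom D)))).Dom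
    rw [cast_assocTarget, pathComp_counit_right]
    trivial
  total_unit_left {A B D} h := by
    rw [intPara_one, intPara_one]
    change (pathComp T (((tensHom (unitHom A) (idHom B)).cast rfl
      (tens_assoc (dual A) A B)).toPath.cons (tensHom (idHom (dual A)) h))).Dom
    rw [cast_assocTarget, pathComp_unit_left]
    trivial
  total_counit_left {A B D} k := by
    rw [intPara_one, intPara_one]
    change (pathComp T ((tensHom (idHom A) k).toPath.cons
      ((tensHom (counitHom A) (idHom D)).cast (tens_assoc A (dual A) D) rfl))).Dom
    rw [cast_assocSource, pathComp_counit_left]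
    trivial
  snake A := by
    rw [intPara_one]
    exact IntObj.snake T A
  snake_dual A := by
    rw [intPara_one]
    exact IntObj.snake_dual T A

theorem Part.map_prod_some {α β γ : Type*} (F : α × β → γ) (a : α) (b : β) :
    Part.map F ((Part.some a).bind fun f => (Part.some b).map fun g => (f, g)) =
      Part.some (F (a, b)) := by
  simp

theorem paraOfCategory_isParacategory (D : Type u) [Category.{v} D] :
    (paraOfCategory D).IsParacategory where
  comp_nil_dom _ := trivial
  comp_toPath f := congrArg Part.some (composePath_toPath f)
  comp_comp r f s h := by
    refine congrArg Part.some ?_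
    rw [composePath_comp, composePath_comp, composePath_comp, composePath_comp, composePath_toPath]
    rfl

theorem paraOfCategory_comp₂ {D : Type u} [Category.{v} D] {X Y Z : D} (f : X ⟶ Y) (g : Y ⟶ Z) :
    (paraOfCategory D).comp₂ f g = Part.some (f ≫ g) :=
  congrArg Part.some (congrArg (· ≫ g) (composePath_toPath f))

theorem symMonParaOfCategory_tensor_isFunctor (C : Type u) [Category.{v} C] [MonoidalCategory C]
    [SymmetricCategory C] :
    ParaData.IsFunctor (P := (paraOfCategory C).prod (paraOfCategory C)) (Q := paraOfCategory C)
      (symMonParaOfCategory C).tensor := by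
  intro X Y p
  refine le_of_eq ?_
  refine (Part.map_prod_some (symMonParaOfCategory C).tensor.map _ _).trans (congrArg Part.some ?_)
  induction p with
  | nil => exact id_tensorHom_id X.1 X.2
  | cons p e ih =>
    exact (tensorHom_comp_tensorHom _ _ _ _).symm.trans (congrArg (· ≫ _) ih)

/-- A strict symmetric monoidal category is a strict symmetric monoidal paracategory. -/
theorem symMonParaOfCategory_isStrictSymmetricMonoidal (C : Type u) [Category.{v} C]
    [MonoidalCategory C] [SymmetricCategory C] [IsStrictMonoidal C] :
    (symMonParaOfCategory C).IsStrictSymmetricMonoidal where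
  toIsParacategory := paraOfCategory_isParacategory C
  tensor_isFunctor := symMonParaOfCategory_tensor_isFunctor C
  assoc_obj := tensor_assoc
  assoc_hom f g h := by
    refine (Quiver.Hom.cast_eq_eqToHom (C := C) _ _ _).trans ?_
    rw [← associator_inv_eq, ← associator_hom_eq]
    exact (Iso.inv_comp_eq _).2 (associator_naturality f g h)
  tensor_unit_obj := tensor_unit
  unit_tensor_obj := unit_tensor
  tensor_unit_hom f := by
    refine (Quiver.Hom.cast_eq_eqToHom (C := C) _ _ _).trans ?_
    rw [← rightUnitor_inv_eq, ← rightUnitor_hom_eq]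
    refine (Iso.inv_comp_eq _).2 ?_
    exact (congrArg (· ≫ _) (tensorHom_id _ _)).trans (rightUnitor_naturality f)
  unit_tensor_hom f := by
    refine (Quiver.Hom.cast_eq_eqToHom (C := C) _ _ _).trans ?_
    rw [← leftUnitor_inv_eq, ← leftUnitor_hom_eq]
    refine (Iso.inv_comp_eq _).2 ?_
    exact (congrArg (· ≫ _) (id_tensorHom _ _)).trans (leftUnitor_naturality f)
  sym_total_left _ := trivial
  sym_total_right _ := trivial
  sym_natural_left {A A'} B f := by
    refine (paraOfCategory_comp₂ (D := C) _ _).trans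
      (.trans (congrArg Part.some ?_) (paraOfCategory_comp₂ (D := C) _ _).symm)
    exact BraidedCategory.braiding_naturality f (𝟙 B)
  sym_natural_right A _ _ g := by
    refine (paraOfCategory_comp₂ (D := C) _ _).trans
      (.trans (congrArg Part.some ?_) (paraOfCategory_comp₂ (D := C) _ _).symm)
    exact BraidedCategory.braiding_naturality (𝟙 A) g
  sym_sym A B :=
    (paraOfCategory_comp₂ (D := C) _ _).trans
      (congrArg Part.some (SymmetricCategory.symmetry (C := C) A B))
  hexagon (A B D : C) := by
    refine (paraOfCategory_comp₂ (D := C) _ _).trans (congrArg Part.some ?_)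
    rw [Quiver.Hom.cast_eq_eqToHom (C := C), Quiver.Hom.cast_eq_eqToHom (C := C),
      ← associator_inv_eq, ← associator_hom_eq, ← associator_inv_eq]
    exact diagram_eq [A, B, D] (0⬝1⬝2) ((1⬝2)⬝0)

namespace IntObj

theorem tensHom_nHom {A B A' B' : C} (f : A ⟶ B) (g : A' ⟶ B') :
    (tensHom (nHom f) (nHom g)).cast (tens_nObj A A') (tens_nObj B B') = nHom (f ⊗ₘ g) := by
  rw [cast_eq (tens_nObj A A') (tens_nObj B B') _ (𝟙 (A ⊗ A')) (λ_ (𝟙_ C)).inv (𝟙 (B ⊗ B'))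
    (λ_ (𝟙_ C)).hom rfl (leftUnitor_inv_eq _ _) rfl (leftUnitor_hom_eq _ _)]
  let L := [A, B, A', B']
  have := IsDiagram.of L 0 1 f
  have := IsDiagram.of L 2 3 g
  exact diagram_eq L ((0⬝2)⬝.unit) ((1⬝3)⬝.unit)

theorem symm_nObj (A B : C) :
    (symm (nObj A) (nObj B)).cast (tens_nObj A B) (tens_nObj B A) = nHom (β_ A B).hom := by
  rw [cast_eq (tens_nObj A B) (tens_nObj B A) _ (𝟙 (A ⊗ B)) (λ_ (𝟙_ C)).inv (𝟙 (B ⊗ A))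
    (λ_ (𝟙_ C)).hom rfl (leftUnitor_inv_eq _ _) rfl (leftUnitor_hom_eq _ _)]
  exact diagram_eq [A, B] ((0⬝1)⬝.unit) ((1⬝0)⬝.unit)

end IntObj

open IntObj in
theorem intN_isStrictSymmetricMonoidalFunctor (T : PartialTrace C) :
    SymMonParaData.IsStrictSymmetricMonoidalFunctor
      (P := symMonParaOfCategory C) (Q := (intP T).toSymMonParaData) (intN T) where
  isFunctor := intN_isFunctor T
  tensor_obj := tens_nObj
  unit_obj := rfl
  tensor_hom := tensHom_nHom
  sym_hom := symm_nObj

end Main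

theorem mainTheorem4 {C : Type u} [Category.{v} C] [MonoidalCategory C] [SymmetricCategory C]
    [IsStrictMonoidal C] (T : PartialTrace C) :
    (intP T).IsCompactClosed ∧
    (symMonParaOfCategory C).IsStrictSymmetricMonoidal ∧
    SymMonParaData.IsStrictSymmetricMonoidalFunctor
      (P := symMonParaOfCategory C) (Q := (intP T).toSymMonParaData) (intN T) ∧
    (∀ A B : (symMonParaOfCategory C).Obj,
      Function.Surjective ((intN T).map : (A ⟶ B) → ((intN T).obj A ⟶ (intN T).obj B))) ∧
    (∀ A B : (symMonParaOfCategory C).Obj,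
      Function.Injective ((intN T).map : (A ⟶ B) → ((intN T).obj A ⟶ (intN T).obj B))) ∧
    ∃ (D : CompactClosedParaData.{v, u}) (F : (symMonParaOfCategory C).Obj ⥤q D.Obj),
      D.IsCompactClosed ∧
      SymMonParaData.IsStrictSymmetricMonoidalFunctor
        (P := symMonParaOfCategory C) (Q := D.toSymMonParaData) F ∧
      (∀ A B : (symMonParaOfCategory C).Obj,
        Function.Surjective (F.map : (A ⟶ B) → (F.obj A ⟶ F.obj B))) ∧
      (∀ A B : (symMonParaOfCategory C).Obj,
        Function.Injective (F.map : (A ⟶ B) → (F.obj A ⟶ F.obj B))) := by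
  have hF : ∀ A B : C, Function.Surjective ((intN T).map : (A ⟶ B) → _) :=
    fun _ _ g => IntObj.nHom_surjective g
  have hI : ∀ A B : C, Function.Injective ((intN T).map : (A ⟶ B) → _) :=
    fun _ _ _ _ h => IntObj.nHom_injective h
  exact ⟨intP_isCompactClosed T, symMonParaOfCategory_isStrictSymmetricMonoidal C,
    intN_isStrictSymmetricMonoidalFunctor T, hF, hI, intP T, intN T, intP_isCompactClosed T,
    intN_isStrictSymmetricMonoidalFunctor T, hF, hI⟩
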